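/- Setting. Let $e_i=z^{-i-1}$ ($i\in\mathbb Z$), let $A=(A_{ij})_{i,j\in\mathbb Z}$ be a complex lower triangular matrix ($A_{ij}=0$ if $j>i$), and let $g=e^{A}$, acting by $g(e_i)=\sum_j g_{ji}e_j$; the entries of $g^{\pm1}=e^{\pm A}$ are defined by sums over finitely many intermediate indices and convergent exponential series (every lower triangular $g$ with nonzero diagonal entries is of this form). The adapted bases are the formal series $$w^g_k(z)=\sum_{j\in\mathbb Z} g_{-j-1,-k}\,z^j,\qquad w^{g*}_k(z)=\sum_{j\in\mathbb Z}(g^{-1})_{k-1,j}\,z^j\qquad(k\in\mathbb Z).$$ On the fermionic Fock space with basis $|\lambda;N\rangle=e_{\ell_1}\wedge e_{\ell_2}\wedge\cdots$, $\ell_i=\lambda_i-i+N$ ($\lambda$ a partition, $N\in\mathbb Z$), put $|N\rangle=|\emptyset;N\rangle$, let $\psi_i$ be exterior multiplication by $e_i$ and $\psi^*_i$ interior multiplication by the dual vector of $e_i$, and set $\psi(z)=\sum_i\psi_iz^i$, $\psi^*(z)=\sum_i\psi^*_iz^{-i-1}$. Let $:\!\psi_i\psi_j^*\!:$ be the normally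 ordered product (equal to $\psi_i\psi_j^*$ if $j\ge 0$ and to $-\psi_j^*\psi_i$ if $j<0$), $J_i=\sum_j:\!\psi_j\psi^*_{j+i}\!:$, $\hat\gamma_+(\mathbf t)=\exp\big(\sum_{i\ge1}t_iJ_i\big)$, and $\hat g=\exp\big(\sum_{i,j}A_{ij}:\!\psi_i\psi_j^*\!:\big)$. All matrix elements are taken in $\mathbb C[[t_1,t_2,\dots]]$. Let $\tau_g(\mathbf t)=\langle0|\hat\gamma_+(\mathbf t)\hat g|0\rangle$, and let the Baker function and its dual be $$\Psi^-_g(z,\mathbf t)=\frac{\langle0|\psi^*_0\hat\gamma_+(\mathbf t)\psi(z)\hat g|0\rangle}{\tau_g(\mathbf t)},\qquad \Psi^+_g(z,\mathbf t)=\frac{\langle0|\psi_{-1}\hat\gamma_+(\mathbf t)\psi^*(z)\hat g|0\rangle}{\tau_g(\mathbf t)},$$ formal series $\sum_{i\in\mathbb Z}c_i(\mathbf t)z^i$ with $c_i\in\mathbb C[[t_1,t_2,\dots]]$. Proposition. The series $\tau_g$ is invertible in $\mathbb C[[t_1,t_2,\dots]]$, and $$\Psi^-_g(z,\mathbf t)=\sum_{j=1}^\infty\alpha^g_j(\mathbf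 t)\,w^{g*}_j(z),\qquad \Psi^+_g(z,\mathbf t)=\sum_{j=1}^\infty\beta^g_j(\mathbf t)\,w^{g}_j(z),$$ where $$\alpha^g_j(\mathbf t)=\frac{\langle0|\psi^*_0\hat\gamma_+(\mathbf t)\hat g\,\psi_{j-1}|0\rangle}{\tau_g(\mathbf t)},\qquad \beta^g_j(\mathbf t)=\frac{\langle0|\psi_{-1}\hat\gamma_+(\mathbf t)\hat g\,\psi^*_{-j}|0\rangle}{\tau_g(\mathbf t)};$$ here, for each power of $z$ and each monomial in $\mathbf t$, only finitely many terms of a sum contribute. Moreover, in the same sense, $$\Psi^-_g(z,\mathbf t)=\frac1{\tau_g(\mathbf t)}\sum_\lambda\langle0|\psi^*_0\hat\gamma_+(\mathbf t)\hat g|\lambda;1\rangle\langle\lambda;1|\hat g^{-1}\psi(z)\hat g|0\rangle,\qquad \Psi^+_g(z,\mathbf t)=\frac1{\tau_g(\mathbf t)}\sum_\lambda\langle0|\psi_{-1}\hat\gamma_+(\mathbf t)\hat g|\lambda;-1\rangle\langle\lambda;-1|\hat g^{-1}\psi^*(z)\hat g|0\rangle,$$ the sums running over all partitions. In the first sum only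 the empty and the one-row partitions contribute: $\langle\lambda;1|\hat g^{-1}\psi(z)\hat g|0\rangle=0$ if $\lambda$ has at least two rows, and for $k\ge0$ $$\langle(k);1|\hat g^{-1}\psi(z)\hat g|0\rangle=w^{g*}_{k+1}(z),\qquad \langle0|\psi^*_0\hat\gamma_+(\mathbf t)\hat g|(k);1\rangle=\tau_g(\mathbf t)\,\alpha^g_{k+1}(\mathbf t).$$ In the second sum only the empty and the one-column partitions contribute: $\langle\lambda;-1|\hat g^{-1}\psi^*(z)\hat g|0\rangle=0$ if $\lambda$ has at least two columns, and for $k\ge0$ $$\langle(1^k);-1|\hat g^{-1}\psi^*(z)\hat g|0\rangle=(-1)^k\,w^{g}_{k+1}(z),\qquad \langle0|\psi_{-1}\hat\gamma_+(\mathbf t)\hat g|(1^k);-1\rangle=(-1)^k\,\tau_g(\mathbf t)\,\beta^g_{k+1}(\mathbf t).$$ -/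

import Mathlib

open scoped MvPowerSeries.WithPiTopology Nat

noncomputable section

namespace FermionicBaker

open Classical in
/-- The identity matrix, for an arbitrary index set. -/
def matOne {ι R : Type*} [Zero R] [One R] : Matrix ι ι R :=
  fun i j => if i = j then 1 else 0

/-- The product of two matrices with an arbitrary (infinite) index set, the sum over the
intermediate index being an unconditionally convergent sum in the topological ring `R`. -/
def matMul {ι R : Type*} [CommRing R] [TopologicalSpace R] (M N : Matrix ι ι R) : Matrix ι ι R :=
  fun i j => ∑' k, M i k * N k j

infixl:70 "⬝" => matMul

/-- Powers of a matrix with arbitrary index set. -/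
def matPow {ι R : Type*} [CommRing R] [TopologicalSpace R] (M : Matrix ι ι R) :
    ℕ → Matrix ι ι R
  | 0 => matOne
  | n + 1 => matPow M n ⬝ M

/-- The matrix exponential `∑ₙ Mⁿ / n!`, computed entry by entry. -/
def matExp {ι R : Type*} [CommRing R] [TopologicalSpace R] [Module ℂ R] (M : Matrix ι ι R) :
    Matrix ι ι R :=
  fun i j => ∑' n : ℕ, ((n ! : ℂ))⁻¹ • matPow M n i j

/-- The ring `ℂ[[t₁, t₂, …]]` of formal power series in the flow variables. It carries the
topology of coefficientwise convergence. -/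
abbrev Flow : Type := MvPowerSeries ℕ+ ℂ

/-- `a = ∑ₖ f k` as a formal power series in `t`: every coefficient receives only finitely many
nonzero contributions, and the sum is `a`. -/
def HasFormalSum {κ : Type*} (f : κ → Flow) (a : Flow) : Prop :=
  (∀ m : ℕ+ →₀ ℕ, {k | MvPowerSeries.coeff m (f k) ≠ 0}.Finite) ∧ HasSum f a

/-- The index set of the basis `e_{ℓ₁} ∧ e_{ℓ₂} ∧ ⋯` (`ℓ₁ > ℓ₂ > ⋯`, eventually consecutive) of the
fermionic Fock space: the sets of occupied sites that contain finitely many integers `≥ 0` and omit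
finitely many integers `< 0`. -/
@[ext] structure Maya where
  sites : Set ℤ
  finite_particles : {i | i ∈ sites ∧ 0 ≤ i}.Finite
  finite_holes : {i | i ∉ sites ∧ i < 0}.Finite

/-- The vacuum `|N⟩ = e_{N-1} ∧ e_{N-2} ∧ ⋯` of charge `N`. -/
def vac (N : ℤ) : Maya where
  sites := {i | i < N}
  finite_particles := (Set.finite_Ico 0 N).subset fun _ hi => ⟨hi.2, hi.1⟩
  finite_holes := (Set.finite_Ico N 0).subset fun _ hi => ⟨not_lt.mp hi.1, hi.2⟩

/-- The basis state `|lam; N⟩ = e_{ℓ₁} ∧ e_{ℓ₂} ∧ ⋯`, where `ℓ_i = lam_i - i + N` for `i ≥ 1`;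
below `k = i - 1`, and partitions are Young diagrams with row lengths `lam.rowLen k`. -/
def state (lam : YoungDiagram) (N : ℤ) : Maya where
  sites := {l | ∃ k : ℕ, l = (lam.rowLen k : ℤ) - ((k : ℤ) + 1) + N}
  finite_particles := by
    refine ((Set.finite_Iio ((lam.rowLen 0 : ℤ) + N).toNat).image
      (fun k : ℕ => (lam.rowLen k : ℤ) - ((k : ℤ) + 1) + N)).subset ?_
    rintro l ⟨⟨k, rfl⟩, hk⟩
    refine ⟨k, ?_, rfl⟩
    have := lam.rowLen_anti 0 k (Nat.zero_le k)
    simp only [Set.mem_Iio]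
    omega
  finite_holes := by
    refine (Set.finite_Ico (N - (lam.colLen 0 : ℤ)) 0).subset ?_
    rintro l ⟨hl, hl0⟩
    refine ⟨?_, hl0⟩
    by_contra h
    apply hl
    refine ⟨(N - l - 1).toNat, ?_⟩
    have h0 : lam.rowLen (N - l - 1).toNat = 0 := by
      by_contra h1
      have h2 : ((N - l - 1).toNat, 0) ∈ lam :=
        YoungDiagram.mem_iff_lt_rowLen.mpr (Nat.pos_of_ne_zero h1)
      have h3 := YoungDiagram.mem_iff_lt_colLen.mp h2
      omega
    rw [h0]
    push_cast
    omega

theorem state_bot (N : ℤ) : state ⊥ N = vac N := by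
  have h : ∀ k, (⊥ : YoungDiagram).rowLen k = 0 := by
    intro k
    by_contra h1
    have h2 : (k, 0) ∈ (⊥ : YoungDiagram) :=
      YoungDiagram.mem_iff_lt_rowLen.mpr (Nat.pos_of_ne_zero h1)
    exact YoungDiagram.notMem_bot _ h2
  ext l
  simp only [state, vac, h, Set.mem_ofPred_eq]
  constructor
  · rintro ⟨k, rfl⟩
    push_cast
    omega
  · intro hl
    refine ⟨(N - l - 1).toNat, ?_⟩
    push_cast
    omega

/-- Operators on the fermionic Fock space, with coefficients in `ℂ[[t]]`, given by their matrix
elements: `O S T = ⟨S| O |T⟩`. -/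
abbrev FockOp : Type := Matrix Maya Maya Flow

/-- The sign obtained when `e_i` is moved to its place in (or from its place to the front of)
the decreasing wedge product with occupied sites `T`. -/
def wedgeSign (i : ℤ) (T : Maya) : Flow := (-1) ^ Set.ncard {j | j ∈ T.sites ∧ i < j}

open Classical in
/-- The creation operator `ψ_i = e_i ∧`. -/
def psi (i : ℤ) : FockOp := fun S T =>
  if i ∉ T.sites ∧ S.sites = insert i T.sites then wedgeSign i T else 0

open Classical in
/-- The annihilation operator `ψ*_i`, interior multiplication by the dual basis element of `e_i`. -/
def psiStar (i : ℤ) : FockOp := fun S T =>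
  if i ∈ T.sites ∧ S.sites = T.sites \ {i} then wedgeSign i T else 0

/-- The normally ordered product `:ψ_i ψ*_j:`. -/
def normalOrder (i j : ℤ) : FockOp :=
  if 0 ≤ j then psi i ⬝ psiStar j else -(psiStar j ⬝ psi i)

/-- `∑_{i,j} A_{ij} :ψ_i ψ*_j:`. -/
def quadratic (A : Matrix ℤ ℤ ℂ) : FockOp :=
  fun S T => ∑' p : ℤ × ℤ, A p.1 p.2 • normalOrder p.1 p.2 S T

/-- The Clifford representation `ĝ = exp(∑ A_{ij} :ψ_i ψ*_j:)` of the group element `g = e^A`.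
In particular `ĝ⁻¹ = ghat (-A)`. -/
def ghat (A : Matrix ℤ ℤ ℂ) : FockOp := matExp (quadratic A)

/-- `J_i = ∑_j :ψ_j ψ*_{j+i}:`. -/
def current (i : ℤ) : FockOp := fun S T => ∑' j : ℤ, normalOrder j (j + i) S T

/-- `γ̂₊(t) = exp(∑_{i ≥ 1} t_i J_i)`. -/
def gammaPlus : FockOp :=
  matExp fun S T => ∑' i : ℕ+, MvPowerSeries.X i * current ((i : ℕ) : ℤ) S T

/-- `⟨N| O |N⟩`. -/
def vev (N : ℤ) (O : FockOp) : Flow := O (vac N) (vac N)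

/-- The tau function `τ_g(N, t) = ⟨N| γ̂₊(t) ĝ |N⟩` of `g = e^A`. -/
def tau (A : Matrix ℤ ℤ ℂ) (N : ℤ) : Flow := vev N (gammaPlus ⬝ ghat A)

/-- The coefficient of `z^i` (`i ∈ ℤ`) in the Baker function
`Ψ⁻_g(z, N, t) = ⟨N| ψ*_N γ̂₊(t) ψ(z) ĝ |N⟩ / τ_g(N, t)`, where `ψ(z) = ∑_i ψ_i z^i`. -/
def bakerMinus (A : Matrix ℤ ℤ ℂ) (N i : ℤ) : Flow :=
  vev N (psiStar N ⬝ gammaPlus ⬝ psi i ⬝ ghat A) * (tau A N)⁻¹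

/-- The coefficient of `z^i` (`i ∈ ℤ`) in the dual Baker function
`Ψ⁺_g(z, N, t) = ⟨N| ψ_{N-1} γ̂₊(t) ψ*(z) ĝ |N⟩ / τ_g(N, t)`, where `ψ*(z) = ∑_i ψ*_i z^{-i-1}`. -/
def bakerPlus (A : Matrix ℤ ℤ ℂ) (N i : ℤ) : Flow :=
  vev N (psi (N - 1) ⬝ gammaPlus ⬝ psiStar (-i - 1) ⬝ ghat A) * (tau A N)⁻¹

/-- The coefficient of `z^i` in the adapted basis element
`w^g_k(z) = g(z^{k-1}) = ∑_i g_{-i-1,-k} z^i`, for `g = e^A` (and `e_i = z^{-i-1}`). -/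
def adapted (A : Matrix ℤ ℤ ℂ) (k i : ℤ) : ℂ := matExp A (-i - 1) (-k)

/-- The coefficient of `z^i` in the dual adapted basis element
`w^{g*}_k(z) = ∑_i (g⁻¹)_{k-1,i} z^i`, for `g = e^A`, `g⁻¹ = e^{-A}`. -/
def adaptedDual (A : Matrix ℤ ℤ ℂ) (k i : ℤ) : ℂ := matExp (-A) (k - 1) i

/-- `α^g_j(t) = ⟨0| ψ*_0 γ̂₊(t) ĝ ψ_{j-1} |0⟩ / τ_g(0, t)`. -/
def alphaCoeff (A : Matrix ℤ ℤ ℂ) (j : ℤ) : Flow :=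
  vev 0 (psiStar 0 ⬝ gammaPlus ⬝ ghat A ⬝ psi (j - 1)) * (tau A 0)⁻¹

/-- `β^g_j(t) = ⟨0| ψ_{-1} γ̂₊(t) ĝ ψ*_{-j} |0⟩ / τ_g(0, t)`. -/
def betaCoeff (A : Matrix ℤ ℤ ℂ) (j : ℤ) : Flow :=
  vev 0 (psi (-1) ⬝ gammaPlus ⬝ ghat A ⬝ psiStar (-j)) * (tau A 0)⁻¹

/-- `⟨0| ψ*_0 γ̂₊(t) ĝ |lam; 1⟩`. -/
def leftMinus (A : Matrix ℤ ℤ ℂ) (lam : YoungDiagram) : Flow :=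
  (psiStar 0 ⬝ gammaPlus ⬝ ghat A) (vac 0) (state lam 1)

/-- The coefficient of `z^i` in `⟨lam; 1| ĝ⁻¹ ψ(z) ĝ |0⟩`. -/
def rightMinus (A : Matrix ℤ ℤ ℂ) (lam : YoungDiagram) (i : ℤ) : Flow :=
  (ghat (-A) ⬝ psi i ⬝ ghat A) (state lam 1) (vac 0)

/-- `⟨0| ψ_{-1} γ̂₊(t) ĝ |lam; -1⟩`. -/
def leftPlus (A : Matrix ℤ ℤ ℂ) (lam : YoungDiagram) : Flow :=
  (psi (-1) ⬝ gammaPlus ⬝ ghat A) (vac 0) (state lam (-1))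

/-- The coefficient of `z^i` in `⟨lam; -1| ĝ⁻¹ ψ*(z) ĝ |0⟩`. -/
def rightPlus (A : Matrix ℤ ℤ ℂ) (lam : YoungDiagram) (i : ℤ) : Flow :=
  (ghat (-A) ⬝ psiStar (-i - 1) ⬝ ghat A) (state lam (-1)) (vac 0)

end FermionicBaker

end

open FermionicBaker

/-!
In the informal picture `ĝ` implements the one-particle operator `g`, that is `ĝ⁻¹ ψ_i ĝ = ∑ₖ
(g⁻¹)_{ki} ψ_k` and `ĝ⁻¹ ψ*_i ĝ = ∑ₖ g_{ik} ψ*_k`. Moving `ψ(z)` to the right of `ĝ` in `⟨0| ψ*_0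
γ̂₊(t) ψ(z) ĝ |0⟩` therefore gives the expansion in the dual adapted basis, where only `k ≥ 0`
survives because `ψ_k |0⟩ = 0` for `k < 0`; and `ψ_k |0⟩ = |(k); 1⟩`, so the sum over intermediate
states is the same sum. The dual case has `ψ*_{-k-1} |0⟩ = (-1)^k |(1^k); -1⟩`.

The work is in making the infinite sums behave. Everything acts from the right on bras. Let `Block
n` be the finite set of Maya diagrams that agree with the vacuum outside the window `[-n, n)`.
Since `A` is lower triangular, `∑ A_{ij} :ψ_i ψ*_j:` acting on a bra can only move particles
downwards, so it maps bras in `Block n` to bras in `Block n`; so do `ψ_i` and `ψ*_i` with `i` in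
the window (`RestrictsTo.quadratic`, `RestrictsTo.psi`, `RestrictsTo.psiStar`). On a block all the
operators are finite matrices, and the conjugation rules (`conj_create`, `conj_annihilate`) follow
from the canonical anticommutation relations and a general lemma on matrix exponentials
(`exp_mul_of_commutator`). Likewise, the exponential of `A` agrees on the window with that of the
truncation of `A` (`matExp_window`).

The operator `γ̂₊(t)` preserves no block, but the coefficient of each monomial in `t` in each of
its rows is finitely supported (`rowFinite_gammaPlus`), as every term of the exponent carries a
variable `t_i` and each `J_i` has finite rows. Hence, for each monomial, the bra `⟨0| ψ*_0 γ̂₊(t)`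
lies in a block, and the expansions reduce to the identities of finite matrices there
(`ConjugationRule.hasFormalSum`).
-/

noncomputable section

namespace FermionicBaker

open MvPowerSeries (coeff)

/-! ### Exponentials of finite matrices -/

section MatrixExponential

open scoped Matrix Kronecker
open NormedSpace (exp)

variable {W n : Type*} [Fintype W] [DecidableEq W] [Fintype n] [DecidableEq n]

theorem hasSum_exp_apply (X : Matrix W W ℂ) (i j : W) :
    HasSum (fun k : ℕ => ((k ! : ℂ))⁻¹ • (X ^ k) i j) (exp X i j) := by
  have h : HasSum (fun k : ℕ => ((k ! : ℂ))⁻¹ • X ^ k) (exp X) := by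
    open scoped Matrix.Norms.Operator in
    exact NormedSpace.exp_series_hasSum_exp' (𝕂 := ℂ) X
  exact Pi.hasSum.mp (Pi.hasSum.mp h i) j

/-- A rectangular matrix that intertwines two square matrices intertwines their exponentials. -/
theorem exp_mul_of_intertwine (X : Matrix W W ℂ) (Y : Matrix n n ℂ) (P : Matrix W n ℂ)
    (h : X * P = P * Y) : exp X * P = P * exp Y := by
  have hpow : ∀ k : ℕ, X ^ k * P = P * Y ^ k := by
    intro k
    induction k with
    | zero => simp
    | succ k ih => rw [pow_succ, Matrix.mul_assoc, h, ← Matrix.mul_assoc, ih, Matrix.mul_assoc,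
        ← pow_succ]
  ext i j
  have h1 : HasSum (fun k : ℕ => ((k ! : ℂ))⁻¹ • (X ^ k * P) i j) ((exp X * P) i j) := by
    simp only [Matrix.mul_apply, Finset.smul_sum, ← smul_mul_assoc]
    exact hasSum_sum fun w _ => (hasSum_exp_apply X i w).mul_right _
  have h2 : HasSum (fun k : ℕ => ((k ! : ℂ))⁻¹ • (P * Y ^ k) i j) ((P * exp Y) i j) := by
    simp only [Matrix.mul_apply, Finset.smul_sum, ← mul_smul_comm]
    exact hasSum_sum fun w _ => (hasSum_exp_apply Y w j).mul_left _
  simp only [hpow] at h1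
  exact h1.unique h2

/-- If the commutator with `X` acts on the linear span of the matrices `P k` through the matrix
`B`, then conjugation by `exp X` acts on it through `exp B`. The family `P` is read as a single
rectangular matrix intertwining `X` with `B ⊗ 1 + 1 ⊗ X`, whose two summands commute. -/
theorem exp_mul_of_commutator (X : Matrix W W ℂ) (B : Matrix n n ℂ) (P : n → Matrix W W ℂ)
    (h : ∀ i, X * P i = P i * X + ∑ k, B k i • P k) (i : n) :
    exp X * P i = (∑ k, exp B k i • P k) * exp X := by
  let Q : Matrix W (n × W) ℂ := fun S p => P p.1 S p.2
  let Y : Matrix (n × W) (n × W) ℂ := B ⊗ₖ (1 : Matrix W W ℂ)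
  let Z : Matrix (n × W) (n × W) ℂ := (1 : Matrix n n ℂ) ⊗ₖ X
  have hQ : ∀ (C : Matrix n n ℂ) (D : Matrix W W ℂ) S (k : n) T,
      (Q * (C ⊗ₖ D)) S (k, T) = ((∑ l, C l k • P l) * D) S T := by
    intro C D S k T
    rw [Matrix.mul_apply, Matrix.mul_apply, Fintype.sum_prod_type, Finset.sum_comm]
    refine Finset.sum_congr rfl fun U _ => ?_
    rw [Matrix.sum_apply, Finset.sum_mul]
    refine Finset.sum_congr rfl fun l _ => ?_
    simp only [Q, Matrix.kronecker_apply, Matrix.smul_apply, smul_eq_mul]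
    ring
  have hone : ∀ k : n, ∑ l, (1 : Matrix n n ℂ) l k • P l = P k := by
    intro k
    simp [Matrix.one_apply]
  have hint : X * Q = Q * (Y + Z) := by
    ext S ⟨k, T⟩
    have h1 := congrFun (congrFun (h k) S) T
    rw [Matrix.mul_add, Matrix.add_apply, hQ, hQ, hone, Matrix.mul_one, add_comm,
      ← Matrix.add_apply, ← h1]
    rfl
  have hcomm : Commute Y Z := by
    simp only [Commute, SemiconjBy, Y, Z, ← Matrix.mul_kronecker_mul, mul_one, one_mul]
  have hY : exp Y = exp B ⊗ₖ (1 : Matrix W W ℂ) := by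
    ext ⟨k, S⟩ ⟨l, T⟩
    have hp : ∀ m : ℕ, Y ^ m = (B ^ m) ⊗ₖ (1 : Matrix W W ℂ) := by
      intro m
      induction m with
      | zero => simp
      | succ m ih => rw [pow_succ, ih, pow_succ, ← Matrix.mul_kronecker_mul, mul_one]
    refine (hasSum_exp_apply Y (k, S) (l, T)).unique ?_
    simp only [hp, Matrix.kronecker_apply, ← smul_mul_assoc]
    exact (hasSum_exp_apply B k l).mul_right _
  have hZ : exp Z = (1 : Matrix n n ℂ) ⊗ₖ exp X := by
    ext ⟨k, S⟩ ⟨l, T⟩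
    have hp : ∀ m : ℕ, Z ^ m = (1 : Matrix n n ℂ) ⊗ₖ (X ^ m) := by
      intro m
      induction m with
      | zero => simp
      | succ m ih => rw [pow_succ, ih, pow_succ, ← Matrix.mul_kronecker_mul, mul_one]
    refine (hasSum_exp_apply Z (k, S) (l, T)).unique ?_
    simp only [hp, Matrix.kronecker_apply, ← mul_smul_comm]
    exact (hasSum_exp_apply X S T).mul_left _
  have key := exp_mul_of_intertwine X (Y + Z) Q hint
  rw [Matrix.exp_add_of_commute Y Z hcomm, hY, hZ, ← Matrix.mul_kronecker_mul, mul_one,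
    one_mul] at key
  ext S T
  rw [← hQ, ← key]
  rfl

theorem exp_neg_mul_exp (X : Matrix W W ℂ) : exp (-X) * exp X = 1 := by
  rw [← Matrix.exp_add_of_commute _ _ (Commute.refl X).neg_left, neg_add_cancel,
    NormedSpace.exp_zero]

theorem exp_mul_exp_neg (X : Matrix W W ℂ) : exp X * exp (-X) = 1 := by
  simpa using exp_neg_mul_exp (-X)

theorem exp_neg_mul_mul_exp (X : Matrix W W ℂ) (B : Matrix n n ℂ) (P : n → Matrix W W ℂ)
    (h : ∀ i, X * P i = P i * X + ∑ k, B k i • P k) (i : n) :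
    exp (-X) * P i * exp X = ∑ k, exp (-B) k i • P k := by
  rw [exp_mul_of_commutator (-X) (-B) P, Matrix.mul_assoc, exp_neg_mul_exp, Matrix.mul_one]
  intro j
  simp only [neg_mul, h j, mul_neg, Matrix.neg_apply, neg_smul, Finset.sum_neg_distrib, neg_add]

end MatrixExponential

/-! ### Lower triangular matrices indexed by the integers -/

section LowerTriangular

/-- Powers of a lower triangular matrix indexed by `ℤ` can be computed in a window `[a, b)`: the
intermediate indices of a nonzero term lie between the outer ones. -/
theorem matPow_window (A : Matrix ℤ ℤ ℂ) (hA : ∀ i j : ℤ, i < j → A i j = 0) (a b : ℤ) (m : ℕ) :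
    (∀ i j : ℤ, i < j → matPow A m i j = 0) ∧ ∀ i j : Set.Ico a b,
      matPow A m i j = ((A.submatrix (↑) (↑) : Matrix (Set.Ico a b) _ ℂ) ^ m) i j := by
  induction m with
  | zero =>
    refine ⟨fun i j hij => by simp [matPow, matOne, hij.ne], fun i j => ?_⟩
    simp [matPow, matOne, Matrix.one_apply, Subtype.ext_iff]
  | succ m ih =>
    refine ⟨fun i j hij => ?_, fun i j => ?_⟩
    · refine (tsum_congr fun k => ?_).trans tsum_zero
      rcases lt_or_ge i k with h | h
      · rw [ih.1 i k h, zero_mul]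
      · rw [hA k j (h.trans_lt hij), mul_zero]
    · rw [pow_succ, Matrix.mul_apply]
      simp only [← ih.2]
      rw [← tsum_fintype (L := .unconditional _)]
      refine (tsum_subtype_eq_of_support_subset (s := Set.Ico a b)
        (f := fun k => matPow A m i k * A k j) fun k hk => ?_).symm
      by_contra hk'
      apply hk
      rcases lt_or_ge (i : ℤ) k with h | h
      · simp [ih.1 i k h]
      · have : k < (j : ℤ) := by
          by_contra h'
          exact hk' ⟨j.2.1.trans (not_lt.mp h'), h.trans_lt i.2.2⟩
        simp [hA k j this]

theorem matExp_window (A : Matrix ℤ ℤ ℂ) (hA : ∀ i j : ℤ, i < j → A i j = 0) (a b : ℤ)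
    (i j : Set.Ico a b) :
    matExp A i j = NormedSpace.exp (A.submatrix (↑) (↑) : Matrix (Set.Ico a b) _ ℂ) i j := by
  rw [← (hasSum_exp_apply _ i j).tsum_eq]
  simp only [matExp, (matPow_window A hA a b _).2]

end LowerTriangular

/-! ### Maya diagrams and signs -/

/-- The Maya diagram `T` with the site `i` filled. -/
def Maya.fill (i : ℤ) (T : Maya) : Maya where
  sites := insert i T.sites
  finite_particles := (T.finite_particles.insert i).subset fun j hj => by
    rcases hj.1 with h | h
    · exact Or.inl h
    · exact Or.inr ⟨h, hj.2⟩
  finite_holes := T.finite_holes.subset fun _ hj => ⟨fun h => hj.1 (Or.inr h), hj.2⟩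

/-- The Maya diagram `T` with the site `i` emptied. -/
def Maya.clear (i : ℤ) (T : Maya) : Maya where
  sites := T.sites \ {i}
  finite_particles := T.finite_particles.subset fun _ hj => ⟨hj.1.1, hj.2⟩
  finite_holes := (T.finite_holes.insert i).subset fun j hj => by
    by_cases h : j = i
    · exact Or.inl h
    · exact Or.inr ⟨fun h' => hj.1 ⟨h', h⟩, hj.2⟩

/-- The sign of `wedgeSign` as a complex number. -/
def wedgeSignC (i : ℤ) (T : Maya) : ℂ := (-1) ^ Set.ncard {j | j ∈ T.sites ∧ i < j}

theorem wedgeSign_eq_C (i : ℤ) (T : Maya) : wedgeSign i T = MvPowerSeries.C (wedgeSignC i T) := by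
  simp [wedgeSign, wedgeSignC]

theorem wedgeSignC_mul_self (i : ℤ) (T : Maya) : wedgeSignC i T * wedgeSignC i T = 1 := by
  rw [wedgeSignC, ← mul_pow]
  simp

theorem Maya.finite_gt (i : ℤ) (T : Maya) : {j | j ∈ T.sites ∧ i < j}.Finite :=
  (T.finite_particles.union (Set.finite_Ico i 0)).subset fun j hj => by
    rcases lt_or_ge j 0 with h | h
    · exact Or.inr ⟨hj.2.le, h⟩
    · exact Or.inl ⟨hj.1, h⟩

theorem wedgeSignC_fill_of_lt {i k : ℤ} {T : Maya} (hk : k ∉ T.sites) (h : i < k) :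
    wedgeSignC i (T.fill k) = -wedgeSignC i T := by
  have : {j | j ∈ (T.fill k).sites ∧ i < j} = insert k {j | j ∈ T.sites ∧ i < j} := by
    ext j
    simp only [Maya.fill, Set.mem_insert_iff, Set.mem_ofPred_eq]
    constructor
    · rintro ⟨rfl | h1, h2⟩ <;> tauto
    · rintro (rfl | h1) <;> tauto
  rw [wedgeSignC, this, Set.ncard_insert_of_notMem (fun h' => hk h'.1) (T.finite_gt i), pow_succ,
    wedgeSignC]
  ring

theorem wedgeSignC_fill_of_le {i k : ℤ} {T : Maya} (h : k ≤ i) :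
    wedgeSignC i (T.fill k) = wedgeSignC i T := by
  have : {j | j ∈ (T.fill k).sites ∧ i < j} = {j | j ∈ T.sites ∧ i < j} := by
    ext j
    simp only [Maya.fill, Set.mem_insert_iff, Set.mem_ofPred_eq]
    constructor
    · rintro ⟨rfl | h1, h2⟩
      · omega
      · exact ⟨h1, h2⟩
    · tauto
  rw [wedgeSignC, this, wedgeSignC]

theorem Maya.fill_clear {k : ℤ} {T : Maya} (h : k ∈ T.sites) : (T.clear k).fill k = T := by
  ext j
  simp only [Maya.fill, Maya.clear, Set.mem_insert_iff, Set.mem_sdiff, Set.mem_singleton_iff]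
  by_cases hj : j = k
  · simp [hj, h]
  · simp [hj]

theorem Maya.clear_fill {k : ℤ} {T : Maya} (h : k ∉ T.sites) : (T.fill k).clear k = T := by
  ext j
  simp only [Maya.fill, Maya.clear, Set.mem_insert_iff, Set.mem_sdiff, Set.mem_singleton_iff]
  by_cases hj : j = k
  · simp [hj, h]
  · simp [hj]

theorem Maya.fill_clear_comm {k l : ℤ} (T : Maya) (h : k ≠ l) :
    (T.clear k).fill l = (T.fill l).clear k := by
  ext j
  simp only [Maya.fill, Maya.clear, Set.mem_insert_iff, Set.mem_sdiff, Set.mem_singleton_iff]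
  by_cases hj : j = l
  · simp [hj, h.symm]
  · simp [hj]

theorem Maya.fill_fill_comm (k l : ℤ) (T : Maya) : (T.fill k).fill l = (T.fill l).fill k := by
  ext j
  simp only [Maya.fill, Set.mem_insert_iff]
  tauto

theorem Maya.mem_fill {j k : ℤ} {T : Maya} : j ∈ (T.fill k).sites ↔ j = k ∨ j ∈ T.sites := Iff.rfl

theorem Maya.mem_clear {j k : ℤ} {T : Maya} :
    j ∈ (T.clear k).sites ↔ j ∈ T.sites ∧ j ≠ k := Iff.rfl

theorem wedgeSignC_clear_of_lt {i k : ℤ} {T : Maya} (hk : k ∈ T.sites) (h : i < k) :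
    wedgeSignC i (T.clear k) = -wedgeSignC i T := by
  conv_rhs => rw [← Maya.fill_clear hk, wedgeSignC_fill_of_lt (by simp [Maya.mem_clear]) h]
  simp

theorem wedgeSignC_clear_of_le {i k : ℤ} {T : Maya} (h : k ≤ i) :
    wedgeSignC i (T.clear k) = wedgeSignC i T := by
  by_cases hk : k ∈ T.sites
  · conv_rhs => rw [← Maya.fill_clear hk, wedgeSignC_fill_of_le h]
  · have : T.clear k = T := by
      ext j
      simp only [Maya.mem_clear]
      exact ⟨fun h => h.1, fun h => ⟨h, fun e => hk (e ▸ h)⟩⟩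
    rw [this]

/-! ### Finite blocks -/

/-- The Maya diagrams in which every site below `-n` is filled and every site from `n` on is
empty: the fermionic Fock space of the finitely many sites of the window `[-n, n)`. -/
def Block (n : ℕ) : Set Maya := {T | Set.Iio (-n : ℤ) ⊆ T.sites ∧ T.sites ⊆ Set.Iio (n : ℤ)}

/-- The sites of the window `[-n, n)`. -/
abbrev Window (n : ℕ) : Type := Set.Ico (-n : ℤ) (n : ℤ)

theorem Block.finite (n : ℕ) : (Block n).Finite := by
  refine Set.Finite.of_injOn (f := fun T : Maya => T.sites ∩ Set.Ico (-n : ℤ) n)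
    (t := 𝒫 (Set.Ico (-n : ℤ) n)) (fun T _ => Set.inter_subset_right) ?_
    (Set.finite_Ico _ _).finite_subsets
  intro S hS T hT h
  ext j
  rcases lt_or_ge j (-n) with h1 | h1
  · exact iff_of_true (hS.1 h1) (hT.1 h1)
  · rcases lt_or_ge j n with h2 | h2
    · have := Set.ext_iff.mp h j
      simpa [h1, h2] using this
    · exact iff_of_false (fun h => absurd (hS.2 h) (not_lt.mpr h2))
        (fun h => absurd (hT.2 h) (not_lt.mpr h2))

instance : DecidableEq Maya := Classical.decEq _

instance (n : ℕ) : Fintype (Block n) := (Block.finite n).fintype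

theorem Block.mono {m n : ℕ} (h : m ≤ n) : Block m ⊆ Block n := fun T hT =>
  ⟨fun j hj => hT.1 (by simp only [Set.mem_Iio] at *; omega),
   fun j hj => by have := hT.2 hj; simp only [Set.mem_Iio] at *; omega⟩

theorem Maya.exists_mem_Block (T : Maya) : ∃ n, T ∈ Block n := by
  obtain ⟨a, ha⟩ := T.finite_holes.bddBelow
  obtain ⟨b, hb⟩ := T.finite_particles.bddAbove
  refine ⟨a.natAbs + b.natAbs + 1, fun j hj => ?_, fun j hj => ?_⟩
  · by_contra h
    simp only [Set.mem_Iio] at hj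
    have := ha (show j ∈ _ from ⟨h, by omega⟩)
    omega
  · by_contra h
    simp only [Set.mem_Iio, not_lt] at h
    have := hb (show j ∈ _ from ⟨hj, by omega⟩)
    omega

theorem vac_zero_mem_Block (n : ℕ) : vac 0 ∈ Block n :=
  ⟨fun j hj => by simp only [vac, Set.mem_Iio, Set.mem_ofPred_eq] at *; omega,
   fun j hj => by simp only [vac, Set.mem_Iio, Set.mem_ofPred_eq] at *; omega⟩

theorem Maya.fill_mem_Block {n : ℕ} {T : Maya} (hT : T ∈ Block n) (k : Window n) :
    T.fill k ∈ Block n :=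
  ⟨fun j hj => Or.inr (hT.1 hj), fun j hj => by
    rcases hj with rfl | hj
    · exact k.2.2
    · exact hT.2 hj⟩

theorem Maya.clear_mem_Block {n : ℕ} {T : Maya} (hT : T ∈ Block n) (k : Window n) :
    T.clear k ∈ Block n :=
  ⟨fun j hj => ⟨hT.1 hj, fun h => by
    have h1 := k.2.1
    have : j = k := h
    simp only [Set.mem_Iio] at hj
    omega⟩, fun j hj => hT.2 hj.1⟩

open Classical in
/-- The creation operator `ψ_k` on the Fock space of the window, as a matrix. -/
def create {n : ℕ} (k : Window n) : Matrix (Block n) (Block n) ℂ := fun S T =>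
  if (k : ℤ) ∉ T.1.sites ∧ S.1 = T.1.fill k then wedgeSignC k T else 0

open Classical in
/-- The annihilation operator `ψ*_k` on the Fock space of the window, as a matrix. -/
def annihilate {n : ℕ} (k : Window n) : Matrix (Block n) (Block n) ℂ := fun S T =>
  if (k : ℤ) ∈ T.1.sites ∧ S.1 = T.1.clear k then wedgeSignC k T else 0

/-! ### Canonical anticommutation relations -/

section CAR

variable {n : ℕ}

open Classical in
theorem mul_create_apply (M : Matrix (Block n) (Block n) ℂ) (k : Window n) (S T : Block n) :
    (M * create k) S T = if (k : ℤ) ∉ T.1.sites then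
      M S ⟨T.1.fill k, Maya.fill_mem_Block T.2 k⟩ * wedgeSignC k T else 0 := by
  rw [Matrix.mul_apply]
  by_cases h : (k : ℤ) ∈ T.1.sites
  · rw [if_neg (not_not.mpr h)]
    exact Finset.sum_eq_zero fun U _ => by simp [create, h]
  · rw [if_pos h, Finset.sum_eq_single ⟨T.1.fill k, Maya.fill_mem_Block T.2 k⟩]
    · simp [create, h]
    · intro U _ hU
      have : U.1 ≠ T.1.fill k := fun h' => hU (Subtype.ext h')
      simp [create, this]
    · simp

open Classical in
theorem mul_annihilate_apply (M : Matrix (Block n) (Block n) ℂ) (k : Window n) (S T : Block n) :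
    (M * annihilate k) S T = if (k : ℤ) ∈ T.1.sites then
      M S ⟨T.1.clear k, Maya.clear_mem_Block T.2 k⟩ * wedgeSignC k T else 0 := by
  rw [Matrix.mul_apply]
  split_ifs with h
  · rw [Finset.sum_eq_single ⟨T.1.clear k, Maya.clear_mem_Block T.2 k⟩]
    · simp [annihilate, h]
    · intro U _ hU
      have : U.1 ≠ T.1.clear k := fun h' => hU (Subtype.ext h')
      simp [annihilate, this]
    · simp
  · exact Finset.sum_eq_zero fun U _ => by simp [annihilate, h]

/-- The signs agree because emptying the site `k` does not change the occupation above `k`. -/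
theorem annihilate_eq_transpose (k : Window n) : annihilate k = (create k).transpose := by
  ext S T
  simp only [annihilate, create, Matrix.transpose_apply]
  have : ((k : ℤ) ∈ T.1.sites ∧ S.1 = T.1.clear k) ↔ ((k : ℤ) ∉ S.1.sites ∧ T.1 = S.1.fill k) := by
    constructor
    · rintro ⟨h1, h2⟩
      rw [h2, Maya.fill_clear h1]
      exact ⟨fun h => h.2 rfl, rfl⟩
    · rintro ⟨h1, h2⟩
      rw [h2, Maya.clear_fill h1]
      exact ⟨Or.inl rfl, rfl⟩
  by_cases h : (k : ℤ) ∉ S.1.sites ∧ T.1 = S.1.fill k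
  · rw [if_pos h, if_pos (this.mpr h), h.2, wedgeSignC_fill_of_le le_rfl]
  · rw [if_neg h, if_neg (this.not.mpr h)]

theorem create_mul_create_add (k l : Window n) : create k * create l + create l * create k = 0 := by
  wlog h : (k : ℤ) ≤ l generalizing k l
  · rw [add_comm]
    exact this l k (le_of_not_ge h)
  ext S T
  simp only [Matrix.add_apply, mul_create_apply, Matrix.zero_apply]
  rcases h.eq_or_lt with h | h
  · simp [create, h, Maya.mem_fill]
  · by_cases hk : (k : ℤ) ∈ T.1.sites
    · simp [create, hk, Maya.mem_fill]
    by_cases hl : (l : ℤ) ∈ T.1.sites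
    · simp [create, hl, Maya.mem_fill]
    simp only [create, hk, hl, Maya.mem_fill, h.ne, h.ne', not_false_eq_true, true_and, or_self,
      if_true, Maya.fill_fill_comm l k, wedgeSignC_fill_of_lt hl h, wedgeSignC_fill_of_le h.le]
    split_ifs <;> ring

theorem annihilate_mul_annihilate_add (k l : Window n) :
    annihilate k * annihilate l + annihilate l * annihilate k = 0 := by
  rw [annihilate_eq_transpose, annihilate_eq_transpose, ← Matrix.transpose_mul,
    ← Matrix.transpose_mul, ← Matrix.transpose_add, create_mul_create_add, Matrix.transpose_zero]

theorem annihilate_mul_create_add (k l : Window n) :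
    annihilate k * create l + create l * annihilate k = if k = l then 1 else 0 := by
  classical
  ext S T
  have h1 : (1 : Matrix (Block n) (Block n) ℂ) S T = if S.1 = T.1 then 1 else 0 := by
    simp [Matrix.one_apply, Subtype.ext_iff]
  rw [Matrix.add_apply, mul_create_apply, mul_annihilate_apply]
  by_cases hkl : k = l
  · subst hkl
    rw [if_pos rfl, h1]
    by_cases hk : (k : ℤ) ∈ T.1.sites
    · simp only [hk, not_true_eq_false, if_false, if_true, create, Maya.mem_clear,
        Maya.fill_clear hk, ne_eq, not_true_eq_false, and_false, not_false_eq_true, true_and,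
        wedgeSignC_clear_of_le le_rfl, zero_add, ite_mul, wedgeSignC_mul_self, zero_mul]
    · simp only [hk, not_false_eq_true, if_false, if_true, annihilate, Maya.mem_fill,
        Maya.clear_fill hk, true_or, true_and,
        wedgeSignC_fill_of_le le_rfl, add_zero, ite_mul, wedgeSignC_mul_self, zero_mul]
  · have hne : (k : ℤ) ≠ l := fun h => hkl (Subtype.ext h)
    rw [if_neg hkl, Matrix.zero_apply]
    by_cases hk : (k : ℤ) ∈ T.1.sites
    swap
    · simp [annihilate, hk, hne, Maya.mem_fill]
    by_cases hl : (l : ℤ) ∈ T.1.sites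
    · simp [create, hl, hne.symm, Maya.mem_clear]
    simp only [create, annihilate, hk, hl, Maya.mem_fill, Maya.mem_clear, hne, or_true,
      not_false_eq_true, true_and, false_and, if_true, Maya.fill_clear_comm _ hne]
    rcases lt_or_gt_of_ne hne with h | h
    · rw [wedgeSignC_fill_of_lt hl h, wedgeSignC_clear_of_le h.le]
      split_ifs <;> ring
    · rw [wedgeSignC_fill_of_le h.le, wedgeSignC_clear_of_lt hk h]
      split_ifs <;> ring

end CAR

/-! ### Quadratic operators on a block -/

section Quadratic

variable {n : ℕ}

/-- The normally ordered product `:ψ_k ψ*_l:` on the Fock space of the window; the subtracted scalar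
is the vacuum expectation value. -/
def normalOrderBlock (k l : Window n) : Matrix (Block n) (Block n) ℂ :=
  create k * annihilate l - if k = l ∧ (l : ℤ) < 0 then 1 else 0

/-- The quadratic operator `∑ A_{kl} :ψ_k ψ*_l:` on the Fock space of the window. -/
def quadraticBlock (A : Matrix (Window n) (Window n) ℂ) : Matrix (Block n) (Block n) ℂ :=
  ∑ k, ∑ l, A k l • normalOrderBlock k l

theorem normalOrderBlock_comm_create (k l i : Window n) :
    normalOrderBlock k l * create i = create i * normalOrderBlock k l +
      if l = i then create k else 0 := by
  have h1 := annihilate_mul_create_add l i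
  have h2 := create_mul_create_add k i
  rw [← eq_sub_iff_add_eq] at h1 h2
  have h3 : create k * annihilate l * create i =
      create i * (create k * annihilate l) + if l = i then create k else 0 := by
    rw [mul_assoc, h1, mul_sub, ← mul_assoc, h2]
    split_ifs
    · rw [mul_one]; noncomm_ring
    · noncomm_ring
  rw [normalOrderBlock, sub_mul, mul_sub, h3]
  split_ifs <;> noncomm_ring

theorem normalOrderBlock_comm_annihilate (k l i : Window n) :
    normalOrderBlock k l * annihilate i = annihilate i * normalOrderBlock k l -
      if k = i then annihilate l else 0 := by
  have h1 := annihilate_mul_create_add i k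
  have h2 := annihilate_mul_annihilate_add l i
  rw [← eq_sub_iff_add_eq] at h1 h2
  have h3 : create k * annihilate l * annihilate i =
      annihilate i * (create k * annihilate l) - if k = i then annihilate l else 0 := by
    rw [← mul_assoc (annihilate i), h1, mul_assoc, h2]
    by_cases h : i = k
    · subst h; simp only [if_true, sub_mul, one_mul]; noncomm_ring
    · simp only [h, Ne.symm h, if_false]; noncomm_ring
  rw [normalOrderBlock, sub_mul, mul_sub, h3]
  split_ifs <;> noncomm_ring

/-- The one-particle matrix `A` acts on creation operators by commutators; the scalar subtracted in
the normal ordering drops out. -/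
theorem quadraticBlock_comm_create (A : Matrix (Window n) (Window n) ℂ) (i : Window n) :
    quadraticBlock A * create i = create i * quadraticBlock A + ∑ k, A k i • create k := by
  simp only [quadraticBlock, Finset.sum_mul, Finset.mul_sum, smul_mul_assoc, mul_smul_comm,
    normalOrderBlock_comm_create, smul_add, Finset.sum_add_distrib, smul_ite, smul_zero,
    Finset.sum_ite_eq', Finset.mem_univ, if_true]

/-- Annihilation operators span the dual representation, with matrix `-Aᵀ`. -/
theorem quadraticBlock_comm_annihilate (A : Matrix (Window n) (Window n) ℂ) (i : Window n) :
    quadraticBlock A * annihilate i =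
      annihilate i * quadraticBlock A + ∑ l, (-A.transpose) l i • annihilate l := by
  have h : ∑ k, ∑ l, (if k = i then A k l • annihilate l else 0) = ∑ l, A i l • annihilate l := by
    rw [Finset.sum_comm]
    simp
  simp only [quadraticBlock, Finset.sum_mul, Finset.mul_sum, smul_mul_assoc, mul_smul_comm,
    normalOrderBlock_comm_annihilate, smul_sub, Finset.sum_sub_distrib, smul_ite, smul_zero,
    Matrix.neg_apply, Matrix.transpose_apply, neg_smul, Finset.sum_neg_distrib]
  rw [h, sub_eq_add_neg]

/-- Conjugation by `exp X_A` acts on creation operators through the matrix `exp A`. -/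
theorem conj_create (A : Matrix (Window n) (Window n) ℂ) (i : Window n) :
    NormedSpace.exp (-quadraticBlock A) * create i * NormedSpace.exp (quadraticBlock A) =
      ∑ k, NormedSpace.exp (-A) k i • create k :=
  exp_neg_mul_mul_exp _ A create (quadraticBlock_comm_create A) i

/-- Conjugation by `exp X_A` acts on annihilation operators through the inverse transpose of the
matrix by which it acts on creation operators. -/
theorem conj_annihilate (A : Matrix (Window n) (Window n) ℂ) (i : Window n) :
    NormedSpace.exp (-quadraticBlock A) * annihilate i * NormedSpace.exp (quadraticBlock A) =
      ∑ l, NormedSpace.exp A i l • annihilate l := by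
  rw [exp_neg_mul_mul_exp _ _ annihilate (quadraticBlock_comm_annihilate A) i]
  simp only [neg_neg, Matrix.exp_transpose, Matrix.transpose_apply]

end Quadratic

/-! ### Operators that preserve finite blocks -/

theorem smul_C (a x : ℂ) : a • (MvPowerSeries.C x : Flow) = MvPowerSeries.C (a * x) := by
  rw [MvPowerSeries.smul_eq_C_mul, map_mul]

theorem exists_ne_zero_of_matMul_ne_zero {P Q : FockOp} {S T : Maya} (h : (P ⬝ Q) S T ≠ 0) :
    ∃ U, P S U ≠ 0 ∧ Q U T ≠ 0 := by
  by_contra! h'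
  refine h ((tsum_congr fun U => ?_).trans tsum_zero)
  by_cases hP : P S U = 0
  · rw [hP, zero_mul]
  · rw [h' U hP, mul_zero]

theorem psi_apply_of_eq {i : ℤ} {S T : Maya} (h : i ∉ T.sites ∧ S = T.fill i) :
    psi i S T = MvPowerSeries.C (wedgeSignC i T) := by
  rw [psi, if_pos ⟨h.1, congrArg Maya.sites h.2⟩, wedgeSign_eq_C]

theorem psi_apply_of_ne {i : ℤ} {S T : Maya} (h : ¬(i ∉ T.sites ∧ S = T.fill i)) :
    psi i S T = 0 :=
  if_neg fun h' => h ⟨h'.1, Maya.ext h'.2⟩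

theorem psiStar_apply_of_eq {i : ℤ} {S T : Maya} (h : i ∈ T.sites ∧ S = T.clear i) :
    psiStar i S T = MvPowerSeries.C (wedgeSignC i T) := by
  rw [psiStar, if_pos ⟨h.1, congrArg Maya.sites h.2⟩, wedgeSign_eq_C]

theorem psiStar_apply_of_ne {i : ℤ} {S T : Maya} (h : ¬(i ∈ T.sites ∧ S = T.clear i)) :
    psiStar i S T = 0 :=
  if_neg fun h' => h ⟨h'.1, Maya.ext h'.2⟩

/-- The bras in which `:ψ_i ψ*_j:` can act nontrivially. -/
theorem normalOrder_ne_zero {i j : ℤ} {S T : Maya} (h : normalOrder i j S T ≠ 0) :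
    (0 ≤ j ∧ i ∈ S.sites ∧ (j ∉ S.sites ∨ j = i)) ∨
      (j < 0 ∧ j ∉ S.sites ∧ (i ∈ S.sites ∨ i = j)) := by
  rw [normalOrder] at h
  split_ifs at h with hj
  · obtain ⟨U, h1, h2⟩ := exists_ne_zero_of_matMul_ne_zero h
    obtain ⟨h3, rfl⟩ := not_not.mp fun h' => h1 (psi_apply_of_ne h')
    obtain ⟨h4, rfl⟩ := not_not.mp fun h' => h2 (psiStar_apply_of_ne h')
    refine Or.inl ⟨hj, Or.inl rfl, ?_⟩
    by_cases hji : j = i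
    · exact Or.inr hji
    · exact Or.inl (by simp [Maya.mem_fill, Maya.mem_clear, hji])
  · have h' : (psiStar j ⬝ psi i) S T ≠ 0 := fun h0 => h (by
      rw [Matrix.neg_apply, h0, neg_zero])
    obtain ⟨U, h1, h2⟩ := exists_ne_zero_of_matMul_ne_zero h'
    obtain ⟨h3, rfl⟩ := not_not.mp fun h' => h1 (psiStar_apply_of_ne h')
    obtain ⟨h4, rfl⟩ := not_not.mp fun h' => h2 (psi_apply_of_ne h')
    refine Or.inr ⟨not_le.mp hj, fun h => h.2 rfl, ?_⟩
    by_cases hji : i = j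
    · exact Or.inr hji
    · exact Or.inl ⟨Or.inl rfl, hji⟩

/-- Acting from the right on bras, the operator `Q` preserves the span of the states in `Block n`,
on which its matrix elements are the constants `q`. -/
structure RestrictsTo (n : ℕ) (Q : FockOp) (q : Matrix (Block n) (Block n) ℂ) : Prop where
  inside : ∀ U T : Block n, Q U T = MvPowerSeries.C (q U T)
  outside : ∀ (U : Block n), ∀ T ∉ Block n, Q U T = 0

namespace RestrictsTo

variable {n : ℕ} {P Q : FockOp} {p q : Matrix (Block n) (Block n) ℂ}

theorem neg (h : RestrictsTo n Q q) : RestrictsTo n (-Q) (-q) where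
  inside U T := by rw [Matrix.neg_apply, h.inside, Matrix.neg_apply, map_neg]
  outside U T hT := by rw [Matrix.neg_apply, h.outside U T hT, neg_zero]

theorem matMul (hP : RestrictsTo n P p) (hQ : RestrictsTo n Q q) :
    RestrictsTo n (P ⬝ Q) (p * q) := by
  have key : ∀ (U : Block n) (T : Maya), (P ⬝ Q) U T = ∑ V : Block n, P U V * Q V T := by
    intro U T
    rw [FermionicBaker.matMul, ← tsum_fintype (L := .unconditional _)]
    refine (tsum_subtype_eq_of_support_subset (s := Block n) (f := fun V => P U V * Q V T)
      fun V hV => ?_).symm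
    by_contra hV'
    exact hV (by simp [hP.outside U V hV'])
  refine ⟨fun U T => ?_, fun U T hT => ?_⟩
  · rw [key, Matrix.mul_apply, map_sum]
    simp only [hP.inside, hQ.inside, map_mul]
  · rw [key]
    exact Finset.sum_eq_zero fun V _ => by rw [hQ.outside V T hT, mul_zero]

theorem one : RestrictsTo n (matOne : FockOp) 1 where
  inside U T := by
    by_cases h : U = T
    · simp [matOne, h, Matrix.one_apply]
    · have : U.1 ≠ T.1 := fun h' => h (Subtype.ext h')
      simp [matOne, h, this]
  outside U T hT := by
    have : U.1 ≠ T := fun h => hT (h ▸ U.2)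
    simp [matOne, this]

theorem matPow (hQ : RestrictsTo n Q q) (k : ℕ) :
    RestrictsTo n (FermionicBaker.matPow Q k) (q ^ k) := by
  induction k with
  | zero => exact one
  | succ k ih => rw [pow_succ]; exact ih.matMul hQ

theorem matExp (hQ : RestrictsTo n Q q) :
    RestrictsTo n (FermionicBaker.matExp Q) (NormedSpace.exp q) where
  inside U T := by
    have h := (hasSum_exp_apply q U T).map (MvPowerSeries.C (σ := ℕ+) (R := ℂ))
      MvPowerSeries.WithPiTopology.continuous_C
    rw [← h.tsum_eq]
    refine tsum_congr fun k => ?_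
    rw [(hQ.matPow k).inside, smul_C]
    rfl
  outside U T hT := by
    refine (tsum_congr fun k => ?_).trans tsum_zero
    rw [(hQ.matPow k).outside U T hT, smul_zero]

theorem psi (k : Window n) : RestrictsTo n (FermionicBaker.psi k) (create k) where
  inside U T := by
    rw [create]
    split_ifs with h
    · exact psi_apply_of_eq h
    · rw [psi_apply_of_ne h, map_zero]
  outside U T hT := psi_apply_of_ne fun h => hT (by
    rw [← Maya.clear_fill h.1, ← h.2]
    exact Maya.clear_mem_Block U.2 k)

theorem psiStar (k : Window n) : RestrictsTo n (FermionicBaker.psiStar k) (annihilate k) where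
  inside U T := by
    rw [annihilate]
    split_ifs with h
    · exact psiStar_apply_of_eq h
    · rw [psiStar_apply_of_ne h, map_zero]
  outside U T hT := psiStar_apply_of_ne fun h => hT (by
    rw [← Maya.fill_clear h.1, ← h.2]
    exact Maya.fill_mem_Block U.2 k)

theorem normalOrder (k l : Window n) :
    RestrictsTo n (FermionicBaker.normalOrder k l) (normalOrderBlock k l) := by
  by_cases hl : 0 ≤ (l : ℤ)
  · rw [FermionicBaker.normalOrder, if_pos hl, normalOrderBlock, if_neg fun h => h.2.not_ge hl,
      sub_zero]
    exact (psi k).matMul (psiStar l)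
  · have hcar : normalOrderBlock k l = -(annihilate l * create k) := by
      rw [normalOrderBlock, eq_neg_iff_add_eq_zero, sub_add_eq_add_sub, add_comm (create k * _),
        annihilate_mul_create_add]
      simp [eq_comm, not_le.mp hl]
    rw [FermionicBaker.normalOrder, if_neg hl, hcar]
    exact ((psiStar l).matMul (psi k)).neg

theorem quadratic (A : Matrix ℤ ℤ ℂ) (hA : ∀ i j : ℤ, i < j → A i j = 0) :
    RestrictsTo n (FermionicBaker.quadratic A) (quadraticBlock (A.submatrix (↑) (↑))) := by
  have key : ∀ (U : Block n) (T : Maya), FermionicBaker.quadratic A U T =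
      ∑ k : Window n, ∑ l : Window n, A k l • FermionicBaker.normalOrder k l U T := by
    intro U T
    rw [FermionicBaker.quadratic, ← Fintype.sum_prod_type',
      ← tsum_fintype (L := .unconditional _)]
    have hinj : Function.Injective (Prod.map (↑) (↑) : Window n × Window n → ℤ × ℤ) :=
      Subtype.val_injective.prodMap Subtype.val_injective
    refine (hinj.tsum_eq (f := fun p : ℤ × ℤ =>
      A p.1 p.2 • FermionicBaker.normalOrder p.1 p.2 U T) ?_).symm
    rintro ⟨i, j⟩ hij
    have h1 : j ≤ i := by
      by_contra h
      exact hij (by simp [hA i j (not_le.mp h)])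
    have h2 : FermionicBaker.normalOrder i j U T ≠ 0 := fun h => hij (by simp [h])
    have hlow : ∀ s : ℤ, s ∉ U.1.sites → -n ≤ s := fun s hs => by
      by_contra h
      exact hs (U.2.1 (not_le.mp h))
    have hhigh : ∀ s : ℤ, s ∈ U.1.sites → s < n := fun s hs => U.2.2 hs
    have h3 : i < n ∧ -n ≤ j := by
      rcases normalOrder_ne_zero h2 with ⟨hj, hi, -⟩ | ⟨hj, hj', hi | hi⟩
      · exact ⟨hhigh i hi, by omega⟩
      · exact ⟨hhigh i hi, hlow j hj'⟩
      · exact ⟨by omega, hlow j hj'⟩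
    exact ⟨(⟨i, by omega, by omega⟩, ⟨j, by omega, by omega⟩), rfl⟩
  refine ⟨fun U T => ?_, fun U T hT => ?_⟩
  · simp only [key, (normalOrder _ _).inside, quadraticBlock, Matrix.sum_apply, Matrix.smul_apply,
      map_sum, smul_C, smul_eq_mul, Matrix.submatrix_apply]
  · rw [key]
    exact Finset.sum_eq_zero fun k _ => Finset.sum_eq_zero fun l _ => by
      rw [(normalOrder k l).outside U T hT, smul_zero]

theorem ghat (A : Matrix ℤ ℤ ℂ) (hA : ∀ i j : ℤ, i < j → A i j = 0) :
    RestrictsTo n (FermionicBaker.ghat A)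
      (NormedSpace.exp (quadraticBlock (A.submatrix (↑) (↑)))) :=
  (quadratic A hA).matExp

theorem ghat_neg (A : Matrix ℤ ℤ ℂ) (hA : ∀ i j : ℤ, i < j → A i j = 0) :
    RestrictsTo n (FermionicBaker.ghat (-A))
      (NormedSpace.exp (-quadraticBlock (A.submatrix (↑) (↑)))) := by
  have h := ghat (n := n) (-A) fun i j hij => by simp [hA i j hij]
  convert h using 2
  simp [quadraticBlock]

end RestrictsTo

/-! ### Coefficientwise finite rows and the operator `γ̂₊(t)` -/

theorem coeff_tsum {κ : Type*} {f : κ → Flow} (hf : Summable f) (m : ℕ+ →₀ ℕ) :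
    coeff m (∑' k, f k) = ∑' k, coeff m (f k) :=
  ((MvPowerSeries.WithPiTopology.hasSum_iff_hasSum_coeff.mp hf.hasSum) m).tsum_eq.symm

/-- No convergence is assumed: a divergent sum is zero by convention. -/
theorem exists_coeff_ne_zero_of_tsum {κ : Type*} {f : κ → Flow} {m : ℕ+ →₀ ℕ}
    (h : coeff m (∑' k, f k) ≠ 0) : ∃ k, coeff m (f k) ≠ 0 := by
  by_contra! h'
  by_cases hf : Summable f
  · rw [coeff_tsum hf] at h
    exact h (by simp [h'])
  · rw [tsum_eq_zero_of_not_summable hf, map_zero] at h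
    exact h rfl

theorem exists_coeff_ne_zero_of_mul {f g : Flow} {m : ℕ+ →₀ ℕ} (h : coeff m (f * g) ≠ 0) :
    ∃ p ∈ Finset.HasAntidiagonal.antidiagonal m, coeff p.1 f ≠ 0 ∧ coeff p.2 g ≠ 0 := by
  classical
  rw [MvPowerSeries.coeff_mul] at h
  obtain ⟨p, hp, hne⟩ := Finset.exists_ne_zero_of_sum_ne_zero h
  exact ⟨p, hp, left_ne_zero_of_mul hne, right_ne_zero_of_mul hne⟩

theorem exists_coeff_ne_zero_of_matMul {P Q : FockOp} {S T : Maya} {m : ℕ+ →₀ ℕ}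
    (h : coeff m ((P ⬝ Q) S T) ≠ 0) :
    ∃ p ∈ Finset.HasAntidiagonal.antidiagonal m, ∃ U,
      coeff p.1 (P S U) ≠ 0 ∧ coeff p.2 (Q U T) ≠ 0 := by
  obtain ⟨U, hU⟩ := exists_coeff_ne_zero_of_tsum h
  obtain ⟨p, hp, h1, h2⟩ := exists_coeff_ne_zero_of_mul hU
  exact ⟨p, hp, U, h1, h2⟩

/-- Every coefficient of every row of the operator is finitely supported. -/
def RowFinite (P : FockOp) : Prop :=
  ∀ (S : Maya) (m : ℕ+ →₀ ℕ), {T | coeff m (P S T) ≠ 0}.Finite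

/-- Every state lies in a finite block whose bras the operator preserves, with constant matrix
elements. -/
def IsLocal (Q : FockOp) : Prop :=
  ∀ S : Maya, ∃ n, S ∈ Block n ∧ ∃ q, RestrictsTo n Q q

namespace RowFinite

theorem matMul {P Q : FockOp} (hP : RowFinite P) (hQ : RowFinite Q) : RowFinite (P ⬝ Q) := by
  intro S m
  refine (Set.Finite.biUnion (Finset.finite_toSet (Finset.HasAntidiagonal.antidiagonal m))
    fun p _ => (hP S p.1).biUnion fun U _ => hQ U p.2).subset fun T hT => ?_
  obtain ⟨p, hp, U, h1, h2⟩ := exists_coeff_ne_zero_of_matMul hT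
  exact Set.mem_biUnion hp (Set.mem_biUnion (show U ∈ _ from h1) h2)

theorem one : RowFinite matOne := by
  intro S m
  refine (Set.finite_singleton S).subset fun T hT => ?_
  by_contra h
  exact hT (by simp [matOne, show S ≠ T from fun h' => h h'.symm])

theorem matPow {P : FockOp} (hP : RowFinite P) (k : ℕ) : RowFinite (FermionicBaker.matPow P k) := by
  induction k with
  | zero => exact one
  | succ k ih => exact ih.matMul hP

theorem summable {P : FockOp} (hP : RowFinite P) (Q : FockOp) (S T : Maya) :
    Summable fun U => P S U * Q U T := by
  refine MvPowerSeries.WithPiTopology.summable_iff_summable_coeff.mpr fun d => ?_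
  refine summable_of_hasFiniteSupport ((Set.Finite.biUnion
    (Finset.finite_toSet (Finset.HasAntidiagonal.antidiagonal d)) fun p _ => hP S p.1).subset
      fun U hU => ?_)
  obtain ⟨p, hp, h1, -⟩ := exists_coeff_ne_zero_of_mul hU
  exact Set.mem_biUnion hp h1

theorem of_isLocal {Q : FockOp} (h : IsLocal Q) : RowFinite Q := by
  intro S m
  obtain ⟨n, hn, q, hq⟩ := h S
  refine (Block.finite n).subset fun T hT => ?_
  by_contra hT'
  exact hT (by rw [hq.outside ⟨S, hn⟩ T hT', map_zero])

end RowFinite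

/-- Every Maya diagram lies in a block whose window contains a given site. -/
theorem Maya.exists_mem_Block_window (S : Maya) (i : ℤ) :
    ∃ n : ℕ, S ∈ Block n ∧ i ∈ Set.Ico (-n : ℤ) n := by
  obtain ⟨n, hn⟩ := S.exists_mem_Block
  exact ⟨n + i.natAbs + 1, Block.mono (by omega) hn, by omega, by omega⟩

theorem isLocal_psi (i : ℤ) : IsLocal (psi i) := fun S => by
  obtain ⟨n, hn, hi⟩ := S.exists_mem_Block_window i
  exact ⟨n, hn, _, RestrictsTo.psi ⟨i, hi⟩⟩

theorem isLocal_psiStar (i : ℤ) : IsLocal (psiStar i) := fun S => by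
  obtain ⟨n, hn, hi⟩ := S.exists_mem_Block_window i
  exact ⟨n, hn, _, RestrictsTo.psiStar ⟨i, hi⟩⟩

theorem isLocal_ghat (A : Matrix ℤ ℤ ℂ) (hA : ∀ i j : ℤ, i < j → A i j = 0) :
    IsLocal (ghat A) := fun S => by
  obtain ⟨n, hn⟩ := S.exists_mem_Block
  exact ⟨n, hn, _, RestrictsTo.ghat A hA⟩

/-- Applied to the bra `⟨S|`, the current `J_i` moves one particle up by `i` sites, so it can reach
only finitely many states: for sites far below, the target is already occupied. -/
theorem finite_current (i : ℕ+) (S : Maya) : {T | current ((i : ℕ) : ℤ) S T ≠ 0}.Finite := by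
  obtain ⟨n, hn⟩ := S.exists_mem_Block
  refine (Block.finite (n + i)).subset fun T hT => ?_
  by_contra hT'
  refine hT ((tsum_congr fun j => ?_).trans tsum_zero)
  by_contra hne
  have hlow : ∀ s : ℤ, s ∉ S.sites → -n ≤ s := fun s hs => by
    by_contra h
    exact hs (hn.1 (not_le.mp h))
  have hhigh : ∀ s : ℤ, s ∈ S.sites → s < n := fun s hs => hn.2 hs
  have hi := i.pos
  have hj : -((n + i : ℕ) : ℤ) ≤ j ∧ j + i < ((n + i : ℕ) : ℤ) := by
    push_cast
    rcases normalOrder_ne_zero hne with ⟨h1, h2, -⟩ | ⟨h1, h2, -⟩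
    · have := hhigh j h2
      omega
    · have := hlow _ h2
      omega
  exact hne ((RestrictsTo.normalOrder (n := n + i) ⟨j, hj.1, by omega⟩
    ⟨j + i, by omega, hj.2⟩).outside ⟨S, Block.mono (by omega) hn⟩ T hT')

/-- The exponent `∑_{i ≥ 1} t_i J_i` of `γ̂₊(t)`. -/
def hamiltonian : FockOp :=
  fun S T => ∑' i : ℕ+, MvPowerSeries.X i * current ((i : ℕ) : ℤ) S T

theorem exists_of_coeff_hamiltonian_ne_zero {S T : Maya} {m : ℕ+ →₀ ℕ}
    (h : coeff m (hamiltonian S T) ≠ 0) :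
    ∃ i ∈ m.support, current ((i : ℕ) : ℤ) S T ≠ 0 := by
  classical
  obtain ⟨i, hi⟩ := exists_coeff_ne_zero_of_tsum h
  obtain ⟨p, hp, h1, h2⟩ := exists_coeff_ne_zero_of_mul hi
  refine ⟨i, ?_, fun h0 => h2 (by rw [h0, map_zero])⟩
  rw [MvPowerSeries.coeff_X] at h1
  have hp1 : p.1 = Finsupp.single i 1 := by
    by_contra h'
    exact h1 (if_neg h')
  rw [← Finset.HasAntidiagonal.mem_antidiagonal.mp hp, hp1]
  simp

theorem rowFinite_hamiltonian : RowFinite hamiltonian := by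
  intro S m
  refine (Set.Finite.biUnion m.support.finite_toSet fun i _ => finite_current i S).subset
    fun T hT => ?_
  obtain ⟨i, hi, h⟩ := exists_of_coeff_hamiltonian_ne_zero hT
  exact Set.mem_biUnion hi h

/-- Every term of the Hamiltonian carries a flow variable, so its `k`-th power only contributes to
monomials of degree at least `k`. -/
theorem le_degree_of_coeff_matPow_ne_zero {k : ℕ} {S T : Maya} {m : ℕ+ →₀ ℕ}
    (h : coeff m (matPow hamiltonian k S T) ≠ 0) : k ≤ m.degree := by
  induction k generalizing T m with
  | zero => exact Nat.zero_le _
  | succ k ih =>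
    obtain ⟨p, hp, U, h1, h2⟩ := exists_coeff_ne_zero_of_matMul h
    obtain ⟨i, hi, -⟩ := exists_of_coeff_hamiltonian_ne_zero h2
    have h3 : p.2.degree ≠ 0 := fun h0 => by
      rw [Finsupp.degree_eq_zero_iff] at h0
      simp [h0] at hi
    rw [← Finset.HasAntidiagonal.mem_antidiagonal.mp hp, map_add]
    have := ih h1
    omega

theorem summable_gammaPlus (S T : Maya) :
    Summable fun k : ℕ => ((k ! : ℂ))⁻¹ • matPow hamiltonian k S T := by
  refine MvPowerSeries.WithPiTopology.summable_iff_summable_coeff.mpr fun d => ?_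
  refine summable_of_hasFiniteSupport ((Set.finite_Iic d.degree).subset fun k hk => ?_)
  refine le_degree_of_coeff_matPow_ne_zero (S := S) (T := T) fun h0 => hk ?_
  simp [h0]

theorem rowFinite_gammaPlus : RowFinite gammaPlus := by
  intro S m
  refine (Set.Finite.biUnion (Set.finite_Iic m.degree) fun k _ =>
    rowFinite_hamiltonian.matPow k S m).subset fun T hT => ?_
  obtain ⟨k, hk⟩ := exists_coeff_ne_zero_of_tsum hT
  have hk' : coeff m (matPow hamiltonian k S T) ≠ 0 := fun h0 => hk (by
    rw [map_smul]
    exact (congrArg _ h0).trans (smul_zero _))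
  exact Set.mem_biUnion (le_degree_of_coeff_matPow_ne_zero hk') hk'

theorem coeff_zero_gammaPlus (S T : Maya) :
    coeff 0 (gammaPlus S T) = if S = T then 1 else 0 := by
  change coeff 0 (∑' k : ℕ, ((k ! : ℂ))⁻¹ • matPow hamiltonian k S T) = _
  rw [coeff_tsum (summable_gammaPlus S T), tsum_eq_single 0]
  · rw [matPow, matOne]
    split_ifs <;> simp
  · intro k hk
    by_contra h
    refine hk (Nat.le_zero.mp ?_)
    have := le_degree_of_coeff_matPow_ne_zero (k := k) (S := S) (T := T) (m := 0) fun h0 => h (by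
      rw [map_smul, h0, smul_zero])
    simpa using this

/-- The coefficient of the monomial `m` in the row `S` of `P`, as a row vector on `Block n`. -/
def coeffRow (n : ℕ) (m : ℕ+ →₀ ℕ) (P : FockOp) (S : Maya) : Block n → ℂ :=
  fun T => coeff m (P S T)

/-- The coefficient of `m` in the row `S` of `P` is supported in `Block n`. -/
def SupportedIn (n : ℕ) (m : ℕ+ →₀ ℕ) (P : FockOp) (S : Maya) : Prop :=
  ∀ T ∉ Block n, coeff m (P S T) = 0

/-! ### Rows supported in a block -/

section CoeffRow

open scoped Matrix

variable {n : ℕ} {m : ℕ+ →₀ ℕ} {P Q : FockOp} {S : Maya} {q : Matrix (Block n) (Block n) ℂ}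

theorem RowFinite.exists_supportedIn (hP : RowFinite P) (m : ℕ+ →₀ ℕ) (S : Maya) (i : ℤ) :
    ∃ n : ℕ, i ∈ Set.Ico (-n : ℤ) n ∧ SupportedIn n m P S := by
  choose f hf using Maya.exists_mem_Block
  obtain ⟨b, hb⟩ := ((hP S m).image f).bddAbove
  refine ⟨b + i.natAbs + 1, ⟨by omega, by omega⟩, fun T hT => ?_⟩
  by_contra h
  have h1 : f T ≤ b := hb (Set.mem_image_of_mem f h)
  exact hT (Block.mono (by omega) (hf T))

theorem IsLocal.exists_eq_C (hQ : IsLocal Q) (S T : Maya) :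
    ∃ c, Q S T = MvPowerSeries.C c := by
  obtain ⟨n, hn, q, hq⟩ := hQ S
  by_cases hT : T ∈ Block n
  · exact ⟨_, hq.inside ⟨S, hn⟩ ⟨T, hT⟩⟩
  · exact ⟨0, by rw [hq.outside ⟨S, hn⟩ T hT, map_zero]⟩

/-- The entries of `Q` have to be constant here: otherwise lower coefficients of the row `S` of `P`,
which may be supported outside the block, would contribute as well. -/
theorem coeff_matMul_of_supportedIn (hP : RowFinite P) (hs : SupportedIn n m P S)
    (hloc : IsLocal Q) (T : Maya) :
    coeff m ((P ⬝ Q) S T) = ∑ U : Block n, coeff m (P S U * Q U T) := by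
  rw [matMul, coeff_tsum (hP.summable Q S T), ← tsum_fintype (L := .unconditional _)]
  refine (tsum_subtype_eq_of_support_subset (s := Block n)
    (f := fun U => coeff m (P S U * Q U T)) fun U hU => ?_).symm
  by_contra hU'
  obtain ⟨c, hc⟩ := hloc.exists_eq_C U T
  exact hU (by simp [hc, hs U hU'])

theorem coeffRow_matMul (hP : RowFinite P) (hs : SupportedIn n m P S)
    (hloc : IsLocal Q) (hQ : RestrictsTo n Q q) :
    coeffRow n m (P ⬝ Q) S = coeffRow n m P S ᵥ* q := by
  ext T
  rw [coeffRow, coeff_matMul_of_supportedIn hP hs hloc]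
  simp only [hQ.inside, MvPowerSeries.coeff_mul_C]
  rfl

theorem SupportedIn.matMul (hs : SupportedIn n m P S) (hP : RowFinite P)
    (hloc : IsLocal Q) (hQ : RestrictsTo n Q q) : SupportedIn n m (P ⬝ Q) S := by
  intro T hT
  rw [coeff_matMul_of_supportedIn hP hs hloc]
  exact Finset.sum_eq_zero fun U _ => by rw [hQ.outside U T hT, mul_zero, map_zero]

end CoeffRow

theorem mem_Block_zero {T : Maya} : T ∈ Block 0 ↔ T = vac 0 := by
  refine ⟨fun h => Maya.ext (Set.Subset.antisymm ?_ ?_), fun h => h ▸ vac_zero_mem_Block 0⟩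
  · exact fun j hj => by simpa [vac] using h.2 hj
  · exact fun j hj => h.1 (by simpa [vac] using hj)

/-- The constant coefficient of the tau function is `1`: `γ̂₊(0)` is the identity, and by
triangularity the vacuum expectation value of `ĝ` is `1`. The latter is read off in `Block 0`, which
contains only the vacuum. -/
theorem coeff_zero_tau (A : Matrix ℤ ℤ ℂ) (hA : ∀ i j : ℤ, i < j → A i j = 0) :
    coeff 0 (tau A 0) = 1 := by
  have hs : SupportedIn 0 0 gammaPlus (vac 0) := fun T hT => by
    rw [coeff_zero_gammaPlus, if_neg fun h => hT (mem_Block_zero.mpr h.symm)]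
  have h := congrFun (coeffRow_matMul rowFinite_gammaPlus hs (isLocal_ghat A hA)
    (RestrictsTo.ghat A hA)) ⟨vac 0, vac_zero_mem_Block 0⟩
  have hq : quadraticBlock (A.submatrix (↑) (↑) : Matrix (Window 0) (Window 0) ℂ) = 0 :=
    Fintype.sum_eq_zero _ fun k => absurd (k.2.1.trans_lt k.2.2) (by simp)
  rw [hq, NormedSpace.exp_zero, Matrix.vecMul_one] at h
  exact h.trans ((coeff_zero_gammaPlus _ _).trans (if_pos rfl))

theorem isUnit_tau (A : Matrix ℤ ℤ ℂ) (hA : ∀ i j : ℤ, i < j → A i j = 0) : IsUnit (tau A 0) := by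
  rw [MvPowerSeries.isUnit_iff_constantCoeff, ← MvPowerSeries.coeff_zero_eq_constantCoeff_apply,
    coeff_zero_tau A hA]
  exact isUnit_one

/-! ### Formal sums -/

namespace HasFormalSum

variable {κ κ' : Type*} {f : κ → Flow} {a : Flow}

theorem of_coeff (h : ∀ m : ℕ+ →₀ ℕ, ∃ s : Finset κ,
    (∀ k ∉ s, coeff m (f k) = 0) ∧ ∑ k ∈ s, coeff m (f k) = coeff m a) : HasFormalSum f a := by
  refine ⟨fun m => ?_, MvPowerSeries.WithPiTopology.hasSum_iff_hasSum_coeff.mpr fun m => ?_⟩ <;>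
    obtain ⟨s, h0, hs⟩ := h m
  · refine s.finite_toSet.subset fun k hk => ?_
    by_contra h'
    exact hk (h0 k h')
  · rw [← hs]
    exact hasSum_sum_of_ne_finset_zero h0

theorem mul_right (h : HasFormalSum f a) (c : Flow) : HasFormalSum (fun k => f k * c) (a * c) := by
  refine ⟨fun m => ?_, h.2.mul_right c⟩
  refine (Set.Finite.biUnion (Finset.finite_toSet (Finset.HasAntidiagonal.antidiagonal m))
    fun p _ => h.1 p.1).subset fun k hk => ?_
  obtain ⟨p, hp, h1, -⟩ := exists_coeff_ne_zero_of_mul hk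
  exact Set.mem_biUnion hp h1

theorem comp_injective (h : HasFormalSum f a) {g : κ' → κ} (hg : g.Injective)
    (h0 : ∀ k ∉ Set.range g, f k = 0) : HasFormalSum (fun k => f (g k)) a :=
  ⟨fun m => (h.1 m).preimage hg.injOn, (hg.hasSum_iff h0).mpr h.2⟩

theorem of_comp_injective {g : κ' → κ} (h : HasFormalSum (fun k => f (g k)) a) (hg : g.Injective)
    (h0 : ∀ k ∉ Set.range g, f k = 0) : HasFormalSum f a := by
  refine ⟨fun m => ((h.1 m).image g).subset fun k hk => ?_, (hg.hasSum_iff h0).mp h.2⟩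
  by_contra h'
  refine hk ?_
  rw [h0 k, map_zero]
  rintro ⟨l, rfl⟩
  exact h' ⟨l, hk, rfl⟩

end HasFormalSum

/-! ### Conjugation by `ĝ` -/

theorem sum_window {M : Type*} [AddCommMonoid M] (n : ℕ) (F : ℤ → M) :
    ∑ k ∈ Finset.Ico (-n : ℤ) n, F k = ∑ k : Window n, F k :=
  Finset.sum_subtype (p := fun k => k ∈ Set.Ico (-n : ℤ) n) _ (fun k => by simp) F

/-- The fields `op k` (all creation or all annihilation operators) are such that
`ĝ⁻¹ (op i) ĝ = ∑ₖ c k • op k`, in every finite block; and only those `op k` with `k` in the window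
of the block can lead from the vacuum into the block. -/
structure ConjugationRule (A : Matrix ℤ ℤ ℂ) (op : ℤ → FockOp) (i : ℤ) (c : ℤ → ℂ) : Prop where
  isLocal : ∀ k, IsLocal (op k)
  conj : ∀ (n : ℕ) (hi : i ∈ Set.Ico (-n : ℤ) n),
    ∃ opB : Window n → Matrix (Block n) (Block n) ℂ,
      (∀ k : Window n, RestrictsTo n (op k) (opB k)) ∧
      NormedSpace.exp (-quadraticBlock (A.submatrix (↑) (↑))) * opB ⟨i, hi⟩ *
        NormedSpace.exp (quadraticBlock (A.submatrix (↑) (↑))) = ∑ k : Window n, c k • opB k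
  vac : ∀ (n : ℕ), ∀ k ∉ Set.Ico (-n : ℤ) n, ∀ U ∈ Block n, op k U (vac 0) = 0

namespace ConjugationRule

open scoped Matrix

variable {A : Matrix ℤ ℤ ℂ} {op : ℤ → FockOp} {i : ℤ} {c : ℤ → ℂ}

/-- Moving `op i` through `ĝ` in front of the vacuum. For each monomial in the flow variables the
bra `⟨0| P` is supported in a finite block, where this is an identity of finite matrices. -/
theorem hasFormalSum (h : ConjugationRule A op i c) (hA : ∀ i j : ℤ, i < j → A i j = 0)
    {P : FockOp} (hP : RowFinite P) :
    HasFormalSum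
      (fun k : ℤ => (P ⬝ ghat A ⬝ op k) (FermionicBaker.vac 0) (FermionicBaker.vac 0) *
        MvPowerSeries.C (c k))
      ((P ⬝ op i ⬝ ghat A) (FermionicBaker.vac 0) (FermionicBaker.vac 0)) := by
  refine .of_coeff fun m => ?_
  obtain ⟨n, hi, hs⟩ := hP.exists_supportedIn m (FermionicBaker.vac 0) i
  obtain ⟨opB, hop, hconj⟩ := h.conj n hi
  have hg := RestrictsTo.ghat (n := n) A hA
  have hgl := isLocal_ghat A hA
  have hPg := hP.matMul (RowFinite.of_isLocal hgl)
  have hsg := hs.matMul hP hgl hg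
  set E := NormedSpace.exp (quadraticBlock (A.submatrix (↑) (↑) : Matrix (Window n) _ ℂ)) with hE
  -- the conjugation rule in the block, with `ĝ` moved to the front
  have hcomm : opB ⟨i, hi⟩ * E = E * ∑ k : Window n, c k • opB k := by
    rw [← hconj, ← mul_assoc, ← mul_assoc, exp_mul_exp_neg, one_mul]
  let v : Block n := ⟨FermionicBaker.vac 0, vac_zero_mem_Block n⟩
  refine ⟨Finset.Ico (-n : ℤ) n, fun k hk => ?_, ?_⟩
  · rw [MvPowerSeries.coeff_mul_C, coeff_matMul_of_supportedIn hPg hsg (h.isLocal k)]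
    rw [Finset.sum_eq_zero, zero_mul]
    intro U _
    rw [h.vac n k (by simpa using hk) U U.2, mul_zero, map_zero]
  · have hlhs : ∀ k : Window n, coeff m ((P ⬝ ghat A ⬝ op k) (FermionicBaker.vac 0)
        (FermionicBaker.vac 0) * MvPowerSeries.C (c k)) =
        (coeffRow n m P (FermionicBaker.vac 0) ᵥ* (E * (c k • opB k))) v := by
      intro k
      have h1 := congrFun (coeffRow_matMul hPg hsg (h.isLocal k) (hop k)) v
      rw [coeffRow_matMul hP hs hgl hg, Matrix.vecMul_vecMul] at h1
      rw [MvPowerSeries.coeff_mul_C, Matrix.mul_smul, Matrix.vecMul_smul, Pi.smul_apply, ← h1,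
        smul_eq_mul, mul_comm]
      rfl
    have hrhs : coeff m ((P ⬝ op i ⬝ ghat A) (FermionicBaker.vac 0) (FermionicBaker.vac 0)) =
        (coeffRow n m P (FermionicBaker.vac 0) ᵥ* (opB ⟨i, hi⟩ * E)) v := by
      have h1 := congrFun (coeffRow_matMul (hP.matMul (RowFinite.of_isLocal (h.isLocal i)))
        (hs.matMul hP (h.isLocal i) (hop ⟨i, hi⟩)) hgl hg) v
      rw [coeffRow_matMul hP hs (h.isLocal i) (hop ⟨i, hi⟩), Matrix.vecMul_vecMul] at h1
      exact h1
    rw [hrhs, hcomm, Finset.mul_sum, Matrix.vecMul_sum, Finset.sum_apply]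
    simp only [← hlhs]
    exact sum_window n _

/-- The matrix elements of `ĝ⁻¹ (op i) ĝ` between a state and the vacuum. -/
theorem exists_conj_apply (h : ConjugationRule A op i c) (hA : ∀ i j : ℤ, i < j → A i j = 0)
    (S : Maya) (k₀ : ℤ) : ∃ n : ℕ, S ∈ Block n ∧ k₀ ∈ Finset.Ico (-n : ℤ) n ∧
      (ghat (-A) ⬝ op i ⬝ ghat A) S (FermionicBaker.vac 0) =
        ∑ k ∈ Finset.Ico (-n : ℤ) n, MvPowerSeries.C (c k) * op k S (FermionicBaker.vac 0) := by
  obtain ⟨n₁, hS, hi⟩ := S.exists_mem_Block_window i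
  set n := n₁ + k₀.natAbs + 1 with hn
  have hS' : S ∈ Block n := Block.mono (by omega) hS
  have hi' : i ∈ Set.Ico (-n : ℤ) n := ⟨by have := hi.1; omega, by have := hi.2; omega⟩
  refine ⟨n, hS', by simp only [Finset.mem_Ico]; omega, ?_⟩
  obtain ⟨opB, hop, hconj⟩ := h.conj n hi'
  have h1 := (((RestrictsTo.ghat_neg A hA).matMul (hop ⟨i, hi'⟩)).matMul
    (RestrictsTo.ghat A hA)).inside ⟨S, hS'⟩ ⟨FermionicBaker.vac 0, vac_zero_mem_Block n⟩
  rw [hconj, Matrix.sum_apply, map_sum] at h1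
  rw [sum_window]
  refine h1.trans ?_
  refine Finset.sum_congr rfl fun k _ => ?_
  rw [Matrix.smul_apply, smul_eq_mul, map_mul, ← (hop k).inside]

theorem conj_apply_eq_zero (h : ConjugationRule A op i c) (hA : ∀ i j : ℤ, i < j → A i j = 0)
    {S : Maya} (h0 : ∀ k, op k S (FermionicBaker.vac 0) = 0) :
    (ghat (-A) ⬝ op i ⬝ ghat A) S (FermionicBaker.vac 0) = 0 := by
  obtain ⟨n, -, -, hn⟩ := h.exists_conj_apply hA S 0
  rw [hn]
  exact Finset.sum_eq_zero fun k _ => by rw [h0, mul_zero]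

theorem conj_apply_eq_single (h : ConjugationRule A op i c) (hA : ∀ i j : ℤ, i < j → A i j = 0)
    {S : Maya} {k₀ : ℤ} (h0 : ∀ k ≠ k₀, op k S (FermionicBaker.vac 0) = 0) :
    (ghat (-A) ⬝ op i ⬝ ghat A) S (FermionicBaker.vac 0) =
      MvPowerSeries.C (c k₀) * op k₀ S (FermionicBaker.vac 0) := by
  obtain ⟨n, -, hk, hn⟩ := h.exists_conj_apply hA S k₀
  rw [hn]
  exact Finset.sum_eq_single_of_mem k₀ hk fun k _ hk => by rw [h0 k hk, mul_zero]

end ConjugationRule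

theorem mem_vac_zero {k : ℤ} : k ∈ (vac 0).sites ↔ k < 0 := Iff.rfl

theorem conjugationRule_psi (A : Matrix ℤ ℤ ℂ) (hA : ∀ i j : ℤ, i < j → A i j = 0) (i : ℤ) :
    ConjugationRule A psi i (fun k => matExp (-A) k i) where
  isLocal := isLocal_psi
  conj n hi := by
    refine ⟨create, RestrictsTo.psi, (conj_create _ _).trans ?_⟩
    refine Finset.sum_congr rfl fun k _ => ?_
    rw [matExp_window (-A) (fun i j hij => by simp [hA i j hij]) (-n) n k ⟨i, hi⟩]
    rfl
  vac n k hk U hU := psi_apply_of_ne fun h => hk (by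
    have h1 : k ∈ U.sites := by rw [h.2]; exact Or.inl rfl
    have h2 : k < n := hU.2 h1
    have h3 := h.1
    rw [mem_vac_zero] at h3
    exact ⟨by omega, h2⟩)

theorem conjugationRule_psiStar (A : Matrix ℤ ℤ ℂ) (hA : ∀ i j : ℤ, i < j → A i j = 0) (i : ℤ) :
    ConjugationRule A psiStar i (fun k => matExp A i k) where
  isLocal := isLocal_psiStar
  conj n hi := by
    refine ⟨annihilate, RestrictsTo.psiStar, (conj_annihilate _ _).trans ?_⟩
    refine Finset.sum_congr rfl fun k _ => ?_
    rw [matExp_window A hA (-n) n ⟨i, hi⟩ k]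
  vac n k hk U hU := psiStar_apply_of_ne fun h => hk (by
    have h1 : k ∉ U.sites := by rw [h.2]; exact fun h' => h'.2 rfl
    have h2 : ¬ k < -n := fun h' => h1 (hU.1 h')
    have h3 := h.1
    rw [mem_vac_zero] at h3
    exact ⟨by omega, by omega⟩)

/-! ### The vacuum and the one-row and one-column states -/

theorem matMul_psi_apply (L : FockOp) (S : Maya) {T : Maya} {k : ℤ} (hk : k ∉ T.sites) :
    (L ⬝ psi k) S T = L S (T.fill k) * MvPowerSeries.C (wedgeSignC k T) := by
  rw [← psi_apply_of_eq ⟨hk, rfl⟩]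
  exact tsum_eq_single _ fun U hU => by rw [psi_apply_of_ne fun h => hU h.2, mul_zero]

theorem matMul_psi_apply_of_mem (L : FockOp) (S : Maya) {T : Maya} {k : ℤ} (hk : k ∈ T.sites) :
    (L ⬝ psi k) S T = 0 :=
  (tsum_congr fun _ => by rw [psi_apply_of_ne fun h => h.1 hk, mul_zero]).trans tsum_zero

theorem matMul_psiStar_apply (L : FockOp) (S : Maya) {T : Maya} {k : ℤ} (hk : k ∈ T.sites) :
    (L ⬝ psiStar k) S T = L S (T.clear k) * MvPowerSeries.C (wedgeSignC k T) := by
  rw [← psiStar_apply_of_eq ⟨hk, rfl⟩]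
  exact tsum_eq_single _ fun U hU => by rw [psiStar_apply_of_ne fun h => hU h.2, mul_zero]

theorem matMul_psiStar_apply_of_notMem (L : FockOp) (S : Maya) {T : Maya} {k : ℤ}
    (hk : k ∉ T.sites) : (L ⬝ psiStar k) S T = 0 :=
  (tsum_congr fun _ => by rw [psiStar_apply_of_ne fun h => hk h.1, mul_zero]).trans tsum_zero

theorem wedgeSignC_vac_of_nonneg {k : ℤ} (hk : 0 ≤ k) : wedgeSignC k (vac 0) = 1 := by
  have : {j | j ∈ (vac 0).sites ∧ k < j} = ∅ := by
    ext j
    simp only [mem_vac_zero, Set.mem_ofPred_eq, Set.mem_empty_iff_false, iff_false]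
    omega
  rw [wedgeSignC, this, Set.ncard_empty, pow_zero]

theorem wedgeSignC_vac_of_neg (k : ℕ) : wedgeSignC (-k - 1) (vac 0) = (-1) ^ k := by
  have : {j | j ∈ (vac 0).sites ∧ -(k : ℤ) - 1 < j} = ↑(Finset.Ico (-(k : ℤ)) 0) := by
    ext j
    simp only [mem_vac_zero, Set.mem_ofPred_eq, Finset.coe_Ico, Set.mem_Ico]
    omega
  rw [wedgeSignC, this, Set.ncard_coe_finset, Int.card_Ico]
  simp

/-! ### One-row and one-column diagrams -/

section YoungDiagrams

variable {lam : YoungDiagram}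

theorem rowLen_eq_zero_of_rowLen_one (h : lam.rowLen 1 = 0) {k : ℕ} (hk : 1 ≤ k) :
    lam.rowLen k = 0 :=
  Nat.le_zero.mp (h ▸ lam.rowLen_anti 1 k hk)

theorem rowLen_of_colLen_one (h : lam.colLen 1 = 0) (k : ℕ) :
    lam.rowLen k = if k < lam.colLen 0 then 1 else 0 := by
  have h1 : ¬ 1 < lam.rowLen k := fun h' => by
    have := YoungDiagram.mem_iff_lt_colLen.mp (YoungDiagram.mem_iff_lt_rowLen.mpr h')
    omega
  have h0 : 0 < lam.rowLen k ↔ k < lam.colLen 0 := by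
    rw [← YoungDiagram.mem_iff_lt_rowLen, YoungDiagram.mem_iff_lt_colLen]
  split_ifs with h2
  · have := h0.mpr h2
    omega
  · have := h0.not.mpr h2
    omega

theorem state_one_of_rowLen_one (h : lam.rowLen 1 = 0) :
    state lam 1 = (vac 0).fill (lam.rowLen 0) := by
  ext l
  rw [Maya.mem_fill, mem_vac_zero]
  constructor
  · rintro ⟨k, rfl⟩
    rcases Nat.eq_zero_or_pos k with rfl | hk
    · left; push_cast; ring
    · right
      rw [rowLen_eq_zero_of_rowLen_one h hk]
      push_cast
      omega
  · rintro (rfl | hl)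
    · exact ⟨0, by push_cast; ring⟩
    · refine ⟨(-l).toNat, ?_⟩
      rw [rowLen_eq_zero_of_rowLen_one h (by omega)]
      push_cast
      omega

theorem state_neg_one_of_colLen_one (h : lam.colLen 1 = 0) :
    state lam (-1) = (vac 0).clear (-(lam.colLen 0 : ℤ) - 1) := by
  ext l
  rw [Maya.mem_clear, mem_vac_zero]
  constructor
  · rintro ⟨k, rfl⟩
    rw [rowLen_of_colLen_one h]
    split_ifs <;> push_cast <;> omega
  · rintro ⟨hl, hne⟩
    by_cases h' : l < -(lam.colLen 0 : ℤ)
    · refine ⟨(-l - 2).toNat, ?_⟩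
      rw [rowLen_of_colLen_one h, if_neg (by omega)]
      push_cast
      omega
    · refine ⟨(-l - 1).toNat, ?_⟩
      rw [rowLen_of_colLen_one h, if_pos (by omega)]
      push_cast
      omega

/-- Two nonempty rows give two particles at sites `≥ 0`, and `ψ_k |0⟩` has at most one. -/
theorem psi_state_one_eq_zero (h : lam.rowLen 1 ≠ 0) (k : ℤ) :
    psi k (state lam 1) (vac 0) = 0 := by
  refine psi_apply_of_ne fun hk => ?_
  have hmem : ∀ m : ℕ, m ≤ 1 → (lam.rowLen m : ℤ) - m = k := by
    intro m hm
    have h1 : (lam.rowLen m : ℤ) - (m + 1) + 1 ∈ (state lam 1).sites := ⟨m, rfl⟩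
    rw [hk.2, Maya.mem_fill, mem_vac_zero] at h1
    have := lam.rowLen_anti m 1 hm
    omega
  have h0 := hmem 0 zero_le_one
  have h1 := hmem 1 le_rfl
  have := lam.rowLen_anti 0 1 zero_le_one
  push_cast at h0 h1
  omega

/-- A second column gives a particle at a site `≥ 0`, and `ψ*_k |0⟩` has none. -/
theorem psiStar_state_neg_one_eq_zero (h : lam.colLen 1 ≠ 0) (k : ℤ) :
    psiStar k (state lam (-1)) (vac 0) = 0 := by
  refine psiStar_apply_of_ne fun hk => ?_
  have h1 : (lam.rowLen 0 : ℤ) - ((0 : ℕ) + 1) + -1 ∈ (state lam (-1)).sites := ⟨0, rfl⟩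
  rw [hk.2, Maya.mem_clear, mem_vac_zero] at h1
  have h2 : 1 < lam.rowLen 0 := YoungDiagram.mem_iff_lt_rowLen.mp
    (YoungDiagram.mem_iff_lt_colLen.mpr (Nat.pos_of_ne_zero h))
  push_cast at h1
  omega

/-- The one-row Young diagram `(k)`. -/
def rowDiagram (k : ℕ) : YoungDiagram where
  cells := {0} ×ˢ Finset.range k
  isLowerSet := by
    rintro ⟨i, j⟩ ⟨i', j'⟩ ⟨hi, hj⟩ h
    simp only [Finset.coe_product, Finset.coe_singleton, Finset.coe_range, Set.mem_prod,
      Set.mem_singleton_iff, Set.mem_Iio] at *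
    omega

theorem mem_rowDiagram {k i j : ℕ} : (i, j) ∈ rowDiagram k ↔ i = 0 ∧ j < k := by
  rw [← YoungDiagram.mem_cells]
  simp [rowDiagram, and_comm, eq_comm]

theorem rowLen_rowDiagram_zero (k : ℕ) : (rowDiagram k).rowLen 0 = k := by
  refine eq_of_forall_lt_iff fun j => ?_
  rw [← YoungDiagram.mem_iff_lt_rowLen, mem_rowDiagram]
  simp

theorem rowLen_rowDiagram_one (k : ℕ) : (rowDiagram k).rowLen 1 = 0 := by
  by_contra h
  have := mem_rowDiagram.mp (YoungDiagram.mem_iff_lt_rowLen.mpr (Nat.pos_of_ne_zero h))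
  omega

theorem rowDiagram_rowLen (h : lam.rowLen 1 = 0) : rowDiagram (lam.rowLen 0) = lam := by
  ext ⟨i, j⟩
  rw [YoungDiagram.mem_cells, YoungDiagram.mem_cells, mem_rowDiagram,
    YoungDiagram.mem_iff_lt_rowLen]
  rcases Nat.eq_zero_or_pos i with rfl | hi
  · simp
  · simp [rowLen_eq_zero_of_rowLen_one h hi, hi.ne']

theorem rowDiagram_injective : Function.Injective rowDiagram :=
  Function.LeftInverse.injective (g := fun lam : YoungDiagram => lam.rowLen 0)
    rowLen_rowDiagram_zero

end YoungDiagrams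

/-! ### The Baker functions -/

variable {A : Matrix ℤ ℤ ℂ}

theorem tau_mul_inv (hA : ∀ i j : ℤ, i < j → A i j = 0) : tau A 0 * (tau A 0)⁻¹ = 1 :=
  MvPowerSeries.mul_inv_cancel _ (by
    rw [← MvPowerSeries.coeff_zero_eq_constantCoeff_apply, coeff_zero_tau A hA]
    exact one_ne_zero)

theorem tau_mul_mul_inv (hA : ∀ i j : ℤ, i < j → A i j = 0) (f : Flow) :
    tau A 0 * (f * (tau A 0)⁻¹) = f := by
  rw [mul_left_comm, tau_mul_inv hA, mul_one]

theorem alphaCoeff_eq_zero {j : ℤ} (hj : j ≤ 0) : alphaCoeff A j = 0 := by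
  rw [alphaCoeff, vev, matMul_psi_apply_of_mem _ _ (by rw [mem_vac_zero]; omega), zero_mul]

theorem betaCoeff_eq_zero {j : ℤ} (hj : j ≤ 0) : betaCoeff A j = 0 := by
  rw [betaCoeff, vev, matMul_psiStar_apply_of_notMem _ _ (by rw [mem_vac_zero]; omega), zero_mul]

/-- The terms with `j ≤ 0` vanish; summing over all integers matches the conjugation rule. -/
theorem hasFormalSum_bakerMinus_int (hA : ∀ i j : ℤ, i < j → A i j = 0) (i : ℤ) :
    HasFormalSum (fun j : ℤ => alphaCoeff A j * MvPowerSeries.C (adaptedDual A j i))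
      (bakerMinus A 0 i) := by
  have h := ((conjugationRule_psi A hA i).hasFormalSum hA
    ((RowFinite.of_isLocal (isLocal_psiStar 0)).matMul rowFinite_gammaPlus)).mul_right (tau A 0)⁻¹
  have h' := h.comp_injective (sub_left_injective (b := (1 : ℤ))) fun k hk =>
    absurd ⟨k + 1, add_sub_cancel_right k 1⟩ hk
  simp only [mul_right_comm _ _ (tau A 0)⁻¹] at h'
  exact h'

theorem hasFormalSum_bakerPlus_int (hA : ∀ i j : ℤ, i < j → A i j = 0) (i : ℤ) :
    HasFormalSum (fun j : ℤ => betaCoeff A j * MvPowerSeries.C (adapted A j i))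
      (bakerPlus A 0 i) := by
  have h := ((conjugationRule_psiStar A hA (-i - 1)).hasFormalSum hA
    ((RowFinite.of_isLocal (isLocal_psi (-1))).matMul rowFinite_gammaPlus)).mul_right (tau A 0)⁻¹
  have h' := h.comp_injective (neg_injective (G := ℤ)) fun k hk =>
    absurd ⟨-k, neg_neg k⟩ hk
  simp only [mul_right_comm _ _ (tau A 0)⁻¹] at h'
  exact h'

/-- A sum over `ℤ` to which only positive integers contribute. -/
theorem HasFormalSum.comp_pnat {f : ℤ → Flow} {a : Flow} (h : HasFormalSum f a)
    (h0 : ∀ j ≤ 0, f j = 0) : HasFormalSum (fun j : ℕ+ => f ((j : ℕ) : ℤ)) a := by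
  refine h.comp_injective (g := fun j : ℕ+ => ((j : ℕ) : ℤ))
    (fun j k hjk => PNat.eq (Nat.cast_injective hjk)) fun k hk => h0 k ?_
  by_contra hk'
  exact hk ⟨⟨k.toNat, by omega⟩, by simp only [PNat.mk_coe]; omega⟩

theorem HasFormalSum.comp_succ {f : ℤ → Flow} {a : Flow} (h : HasFormalSum f a)
    (h0 : ∀ j ≤ 0, f j = 0) : HasFormalSum (fun k : ℕ => f ((k : ℤ) + 1)) a := by
  refine h.comp_injective (g := fun k : ℕ => (k : ℤ) + 1)
    (fun j k hjk => by simpa using hjk) fun k hk => h0 k ?_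
  by_contra hk'
  exact hk ⟨k.toNat - 1, show ((k.toNat - 1 : ℕ) : ℤ) + 1 = k by omega⟩

theorem rightMinus_eq_zero (hA : ∀ i j : ℤ, i < j → A i j = 0) {lam : YoungDiagram}
    (h : lam.rowLen 1 ≠ 0) (i : ℤ) : rightMinus A lam i = 0 :=
  (conjugationRule_psi A hA i).conj_apply_eq_zero hA (psi_state_one_eq_zero h)

theorem rightPlus_eq_zero (hA : ∀ i j : ℤ, i < j → A i j = 0) {lam : YoungDiagram}
    (h : lam.colLen 1 ≠ 0) (i : ℤ) : rightPlus A lam i = 0 :=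
  (conjugationRule_psiStar A hA (-i - 1)).conj_apply_eq_zero hA (psiStar_state_neg_one_eq_zero h)

theorem rightMinus_of_rowLen_one (hA : ∀ i j : ℤ, i < j → A i j = 0) {lam : YoungDiagram}
    (h : lam.rowLen 1 = 0) (i : ℤ) :
    rightMinus A lam i = MvPowerSeries.C (adaptedDual A ((lam.rowLen 0 : ℤ) + 1) i) := by
  have hmem : (lam.rowLen 0 : ℤ) ∉ (vac 0).sites := by rw [mem_vac_zero]; omega
  rw [rightMinus, state_one_of_rowLen_one h,
    (conjugationRule_psi A hA i).conj_apply_eq_single hA (k₀ := lam.rowLen 0)]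
  · rw [psi_apply_of_eq ⟨hmem, rfl⟩, wedgeSignC_vac_of_nonneg (by omega), map_one, mul_one,
      adaptedDual, add_sub_cancel_right]
  · intro k hk
    refine psi_apply_of_ne fun h' => ?_
    have h1 : (lam.rowLen 0 : ℤ) ∈ ((vac 0).fill k).sites := by rw [← h'.2]; exact Or.inl rfl
    exact h1.elim (fun h2 => hk h2.symm) hmem

theorem rightPlus_of_colLen_one (hA : ∀ i j : ℤ, i < j → A i j = 0) {lam : YoungDiagram}
    (h : lam.colLen 1 = 0) (i : ℤ) :
    rightPlus A lam i = (-1) ^ lam.colLen 0 *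
      MvPowerSeries.C (adapted A ((lam.colLen 0 : ℤ) + 1) i) := by
  have hmem : -(lam.colLen 0 : ℤ) - 1 ∈ (vac 0).sites := by rw [mem_vac_zero]; omega
  rw [rightPlus, state_neg_one_of_colLen_one h,
    (conjugationRule_psiStar A hA (-i - 1)).conj_apply_eq_single hA
      (k₀ := -(lam.colLen 0 : ℤ) - 1)]
  · rw [psiStar_apply_of_eq ⟨hmem, rfl⟩, wedgeSignC_vac_of_neg, adapted, mul_comm, neg_add',
      map_pow, map_neg, map_one]
  · intro k hk
    refine psiStar_apply_of_ne fun h' => ?_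
    have h1 : -(lam.colLen 0 : ℤ) - 1 ∉ ((vac 0).clear k).sites := by
      rw [← h'.2]
      exact fun h2 => h2.2 rfl
    exact h1 ⟨hmem, fun h2 => hk h2.symm⟩

theorem leftMinus_of_rowLen_one (hA : ∀ i j : ℤ, i < j → A i j = 0) {lam : YoungDiagram}
    (h : lam.rowLen 1 = 0) :
    leftMinus A lam = tau A 0 * alphaCoeff A ((lam.rowLen 0 : ℤ) + 1) := by
  rw [alphaCoeff, tau_mul_mul_inv hA, vev, add_sub_cancel_right,
    matMul_psi_apply _ _ (by rw [mem_vac_zero]; omega), wedgeSignC_vac_of_nonneg (by omega),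
    map_one, mul_one, leftMinus, state_one_of_rowLen_one h]

theorem leftPlus_of_colLen_one (hA : ∀ i j : ℤ, i < j → A i j = 0) {lam : YoungDiagram}
    (h : lam.colLen 1 = 0) :
    leftPlus A lam =
      (-1) ^ lam.colLen 0 * (tau A 0 * betaCoeff A ((lam.colLen 0 : ℤ) + 1)) := by
  rw [betaCoeff, tau_mul_mul_inv hA, vev, neg_add',
    matMul_psiStar_apply _ _ (by rw [mem_vac_zero]; omega), wedgeSignC_vac_of_neg, leftPlus,
    state_neg_one_of_colLen_one h, map_pow, map_neg, map_one, mul_left_comm, ← mul_pow]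
  simp

theorem hasFormalSum_bakerMinus_states (hA : ∀ i j : ℤ, i < j → A i j = 0) (i : ℤ) :
    HasFormalSum (fun lam : YoungDiagram => (tau A 0)⁻¹ * (leftMinus A lam * rightMinus A lam i))
      (bakerMinus A 0 i) := by
  refine HasFormalSum.of_comp_injective (g := rowDiagram) ?_ rowDiagram_injective ?_
  · convert (hasFormalSum_bakerMinus_int hA i).comp_succ
      (fun j hj => by rw [alphaCoeff_eq_zero hj, zero_mul]) using 2 with k
    rw [leftMinus_of_rowLen_one hA (rowLen_rowDiagram_one k),
      rightMinus_of_rowLen_one hA (rowLen_rowDiagram_one k), rowLen_rowDiagram_zero, mul_assoc,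
      ← mul_assoc, mul_comm (tau A 0)⁻¹, tau_mul_inv hA, one_mul]
  · intro lam hlam
    by_cases h : lam.rowLen 1 = 0
    · exact absurd ⟨_, rowDiagram_rowLen h⟩ hlam
    · rw [rightMinus_eq_zero hA h, mul_zero, mul_zero]

theorem hasFormalSum_bakerPlus_states (hA : ∀ i j : ℤ, i < j → A i j = 0) (i : ℤ) :
    HasFormalSum (fun lam : YoungDiagram => (tau A 0)⁻¹ * (leftPlus A lam * rightPlus A lam i))
      (bakerPlus A 0 i) := by
  refine HasFormalSum.of_comp_injective (g := fun k => (rowDiagram k).transpose) ?_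
    (YoungDiagram.transposeOrderIso.injective.comp rowDiagram_injective) ?_
  · convert (hasFormalSum_bakerPlus_int hA i).comp_succ
      (fun j hj => by rw [betaCoeff_eq_zero hj, zero_mul]) using 2 with k
    have h1 : (rowDiagram k).transpose.colLen 1 = 0 := by
      rw [YoungDiagram.colLen_transpose, rowLen_rowDiagram_one]
    have hsign : ((-1 : Flow) ^ k) * (-1) ^ k = 1 := by
      rw [← mul_pow]
      simp
    rw [leftPlus_of_colLen_one hA h1, rightPlus_of_colLen_one hA h1,
      YoungDiagram.colLen_transpose, rowLen_rowDiagram_zero, mul_mul_mul_comm, hsign, one_mul,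
      mul_assoc, ← mul_assoc, mul_comm (tau A 0)⁻¹, tau_mul_inv hA, one_mul]
  · intro lam hlam
    by_cases h : lam.colLen 1 = 0
    · refine absurd ⟨lam.colLen 0, ?_⟩ hlam
      have h1 : lam.transpose.rowLen 1 = 0 := by rw [YoungDiagram.rowLen_transpose, h]
      have h2 := rowDiagram_rowLen h1
      rw [YoungDiagram.rowLen_transpose] at h2
      simp only [h2, YoungDiagram.transpose_transpose]
    · rw [rightPlus_eq_zero hA h, mul_zero, mul_zero]

end FermionicBaker

end

open FermionicBaker

theorem mainTheorem9 (A : Matrix ℤ ℤ ℂ) (hA : ∀ i j : ℤ, i < j → A i j = 0) :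
    -- the denominator is invertible
    IsUnit (tau A 0) ∧
    -- the two expansions, coefficient of `z^i` for every integer `i`
    (∀ i : ℤ, HasFormalSum
      (fun j : ℕ+ => alphaCoeff A ((j : ℕ) : ℤ) * MvPowerSeries.C (adaptedDual A ((j : ℕ) : ℤ) i))
      (bakerMinus A 0 i)) ∧
    (∀ i : ℤ, HasFormalSum
      (fun j : ℕ+ => betaCoeff A ((j : ℕ) : ℤ) * MvPowerSeries.C (adapted A ((j : ℕ) : ℤ) i))
      (bakerPlus A 0 i)) ∧
    -- the sum over intermediate states of charge `1`: only `lam = (k)`, `k ≥ 0`, contributes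
    (∀ i : ℤ, HasFormalSum
      (fun lam : YoungDiagram => (tau A 0)⁻¹ * (leftMinus A lam * rightMinus A lam i))
      (bakerMinus A 0 i)) ∧
    (∀ lam : YoungDiagram, lam.rowLen 1 ≠ 0 → ∀ i : ℤ, rightMinus A lam i = 0) ∧
    (∀ lam : YoungDiagram, lam.rowLen 1 = 0 →
      leftMinus A lam = tau A 0 * alphaCoeff A ((lam.rowLen 0 : ℤ) + 1) ∧
      ∀ i : ℤ, rightMinus A lam i =
        MvPowerSeries.C (adaptedDual A ((lam.rowLen 0 : ℤ) + 1) i)) ∧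
    -- the sum over intermediate states of charge `-1`: only `lam = (1^k)`, `k ≥ 0`, contributes
    (∀ i : ℤ, HasFormalSum
      (fun lam : YoungDiagram => (tau A 0)⁻¹ * (leftPlus A lam * rightPlus A lam i))
      (bakerPlus A 0 i)) ∧
    (∀ lam : YoungDiagram, lam.colLen 1 ≠ 0 → ∀ i : ℤ, rightPlus A lam i = 0) ∧
    (∀ lam : YoungDiagram, lam.colLen 1 = 0 →
      leftPlus A lam = (-1) ^ lam.colLen 0 * (tau A 0 * betaCoeff A ((lam.colLen 0 : ℤ) + 1)) ∧
      ∀ i : ℤ, rightPlus A lam i = (-1) ^ lam.colLen 0 *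
        MvPowerSeries.C (adapted A ((lam.colLen 0 : ℤ) + 1) i)) := by
  refine ⟨isUnit_tau A hA, fun i => ?_, fun i => ?_, hasFormalSum_bakerMinus_states hA,
    fun _ h => rightMinus_eq_zero hA h,
    fun _ h => ⟨leftMinus_of_rowLen_one hA h, rightMinus_of_rowLen_one hA h⟩,
    hasFormalSum_bakerPlus_states hA, fun _ h => rightPlus_eq_zero hA h,
    fun _ h => ⟨leftPlus_of_colLen_one hA h, rightPlus_of_colLen_one hA h⟩⟩
  · exact (hasFormalSum_bakerMinus_int hA i).comp_pnat fun j hj => by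
      rw [alphaCoeff_eq_zero hj, zero_mul]
  · exact (hasFormalSum_bakerPlus_int hA i).comp_pnat fun j hj => by
      rw [betaCoeff_eq_zero hj, zero_mul]
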